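/- Let $G$ be a countable infinite discrete Abelian group and let $(F_n)_{n\ge 0}$, $(C_n)_{n\ge 1}$ be sequences of finite subsets of $G$ such that $F_0=\{0\}$, $0\in F_n$ for all $n$ and $\#C_n>1$ for all $n\ge1$; for all $n\ge 0$: $F_n+C_{n+1}\subset F_{n+1}$, and $(F_n+c)\cap(F_n+c')=\emptyset$ for distinct $c,c'\in C_{n+1}$; and for all $g\in G$ and $n>0$ there is $m>n$ with $g+F_n+C_{n+1}+\dots+C_m\subset F_m$. Let $X_n=F_n\times C_{n+1}\times C_{n+2}\times\cdots$ with the product topology, and let $X$ be the inductive limit of the $X_n$ along the embeddings $(f_n,c_{n+1},c_{n+2},\dots)\mapsto(f_n+c_{n+1},c_{n+2},\dots)$ of $X_n$ into $X_{n+1}$. For $A\subset F_n$ let $[A]_n=\{(f_n,c_{n+1},\dots)\in X_n: f_n\in A\}$ (an $n$-cylinder), $[f]_n=[\{f\}]_n$. Let $\mu$ be the $(C,F)$-measure, i.e. the $\sigma$-finite Borel measure on $X$ with $\mu([A]_n)=\#A/(\#C_1\cdots\#C_n)$, and let $T=(T_g)_{g\in G}$ be the $(C,F)$-action on $X$: $T_g(f_n,c_{n+1},\dots)=(g+f_n,c_{n+1},\dots)$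 whenever $g+f_n\in F_n$. Assume that one of the following three conditions holds: (i) for all cylinders $A,B\subset[0]_0$, $$\lim_{n\to\infty}\frac{\sum_{g\in F_n-F_n}\mu(A\cap T_gB)}{\sum_{g\in F_n-F_n}\mu([0]_0\cap T_g[0]_0)}=\mu(A)\mu(B);\qquad(*)$$ (ii) for all $l>0$ and $h\in F_l-F_l$, $\ \sum_{g\in F_n-F_n+h}\mu([0]_l\cap T_g[0]_l)\sim\sum_{g\in F_n-F_n}\mu([0]_l\cap T_g[0]_l)$ as $n\to\infty$; (iii) for all $l>0$ and $h\in F_l-F_l$, $$\lim_{n\to\infty}\lim_{L\to\infty}\frac{\nu_{C_{l+1}+\cdots+C_L}*\nu_{-C_{l+1}-\cdots-C_L}(F_n-F_n)}{\nu_{C_{l+1}+\cdots+C_L}*\nu_{-C_{l+1}-\cdots-C_L}(F_n-F_n+h)}=1,$$ where $\nu_D=\sum_{g\in D}\delta_g$ for finite $D\subset G$ (the inner limit being required to exist for all large $n$). Assume also that there is an integer $K>0$ such that for every $n$ the set $F_n-F_n$ is covered by $K$ translates $d_{n,1}+F_n,\dots,d_{n,K}+F_n$ of $F_n$. Then: (a)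 $(*)$ holds for all Borel sets $A,B\subset[0]_0$. (b) $T$ is weakly rationally ergodic along $S_n=F_n-F_n$, $n\ge0$. That is, $T$ is an ergodic conservative measure preserving action on the $\sigma$-finite space $(X,\mu)$, the sequence $(S_n)$ is increasing, and there is a measurable set $Y\subset X$ with $0<\mu(Y)<\infty$ such that $$\lim_{n\to\infty}\frac1{a_n(Y)}\sum_{g\in S_n}\mu(A\cap T_gB)=\mu(A)\mu(B)\quad\text{for all measurable }A,B\subset Y,\qquad a_n(Y)=\sum_{g\in S_n}\frac{\mu(Y\cap T_gY)}{\mu(Y)^2}.$$ (c) $T$ is non-squashable: every nonsingular transformation $Q$ of $(X,\mu)$ (measurable, invertible modulo null sets, with $Q$ and $Q^{-1}$ pulling null sets back to null sets) that commutes with every $T_g$ almost everywhere preserves $\mu$. -/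

import Mathlib

open MeasureTheory Filter Topology Asymptotics
open scoped Pointwise

noncomputable section

/-- Sequences `(C_{n+1}, F_n)`, `n ≥ 0`, of finite subsets of an Abelian group satisfying the
conditions of the `(C,F)`-construction, together with the condition under which the
`(C,F)`-action is defined everywhere.  The value `C 0` plays no role. -/
structure CFSequence (G : Type*) [AddCommGroup G] [DecidableEq G] where
  /-- the sets `F_n`, `n ≥ 0` -/
  F : ℕ → Finset G
  /-- the sets `C_n`, `n ≥ 1` -/
  C : ℕ → Finset G
  F_zero : F 0 = {0}
  one_lt_card_C : ∀ n, 0 < n → 1 < (C n).card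
  add_subset : ∀ n, F n + C (n + 1) ⊆ F (n + 1)
  disjoint : ∀ n, ∀ c ∈ C (n + 1), ∀ c' ∈ C (n + 1), c ≠ c' → Disjoint (F n + {c}) (F n + {c'})
  absorb : ∀ (g : G) (n : ℕ), 0 < n →
    ∃ m, n < m ∧ {g} + F n + ∑ i ∈ Finset.Ioc n m, C i ⊆ F m

/-- A finite subset of `G` viewed as a finite discrete space. -/
def Letter {G : Type*} (s : Finset G) : Type _ := {g : G // g ∈ s}

namespace Letter

variable {G : Type*} (s : Finset G)

instance : TopologicalSpace (Letter s) := ⊥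

instance : DiscreteTopology (Letter s) := ⟨rfl⟩

instance : MeasurableSpace (Letter s) := ⊤

instance : DiscreteMeasurableSpace (Letter s) := ⟨fun _ => trivial⟩

instance : Finite (Letter s) := inferInstanceAs (Finite {g : G // g ∈ s})

end Letter

namespace CFSequence

variable {G : Type*} [AddCommGroup G] [DecidableEq G] (S : CFSequence G)

/-- `X_n = F_n × C_{n+1} × C_{n+2} × ⋯`, with the product topology. -/
abbrev Level (n : ℕ) : Type _ := Letter (S.F n) × ((i : Set.Ioi n) → Letter (S.C i))

variable {S}

/-- The coordinate `c_i`, `i > n`, of a point of `X_n`. -/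
def coord {n : ℕ} (x : S.Level n) (i : ℕ) : G := if h : n < i then (x.2 ⟨i, h⟩).1 else 0

theorem coord_mem {n : ℕ} (x : S.Level n) {i : ℕ} (h : n < i) : coord x i ∈ S.C i := by
  simp only [coord, h, dite_true]
  exact (x.2 ⟨i, h⟩).2

theorem head_mem {n : ℕ} (x : S.Level n) {m : ℕ} (h : n ≤ m) :
    x.1.1 + ∑ i ∈ Finset.Ioc n m, coord x i ∈ S.F m := by
  induction m, h using Nat.le_induction with
  | base => simpa using x.1.2
  | succ m h ih =>
    rw [Finset.sum_Ioc_succ_top h, ← add_assoc]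
    exact S.add_subset m (Finset.add_mem_add ih (coord_mem x (Nat.lt_succ_of_le h)))

/-- The embedding
`(f_n, c_{n+1}, c_{n+2}, …) ↦ (f_n + c_{n+1} + ⋯ + c_m, c_{m+1}, …)` of `X_n` into `X_m`. -/
def embed {n m : ℕ} (h : n ≤ m) (x : S.Level n) : S.Level m :=
  (⟨x.1.1 + ∑ i ∈ Finset.Ioc n m, coord x i, head_mem x h⟩,
    fun i => x.2 ⟨i, lt_of_le_of_lt h i.2⟩)

theorem level_ext {n : ℕ} {x y : S.Level n} (h₁ : x.1.1 = y.1.1)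
    (h₂ : ∀ i, n < i → coord x i = coord y i) : x = y := by
  refine Prod.ext (Subtype.ext h₁) (funext fun i => Subtype.ext ?_)
  have := h₂ i i.2
  have hi : n < (i : ℕ) := i.2
  simpa [coord, hi] using this

theorem coord_embed {n m : ℕ} (h : n ≤ m) (x : S.Level n) {i : ℕ} (hi : m < i) :
    coord (embed h x) i = coord x i := by
  have : n < i := lt_of_le_of_lt h hi
  simp [coord, embed, hi, this]

theorem embed_refl {n : ℕ} (x : S.Level n) : embed le_rfl x = x :=
  level_ext (by simp [embed]) (fun _ hi => coord_embed _ _ hi)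

theorem embed_embed {n m k : ℕ} (h : n ≤ m) (h' : m ≤ k) (x : S.Level n) :
    embed h' (embed h x) = embed (h.trans h') x := by
  refine level_ext ?_ fun i hi => ?_
  · have e : ∑ i ∈ Finset.Ioc m k, coord (embed h x) i = ∑ i ∈ Finset.Ioc m k, coord x i :=
      Finset.sum_congr rfl fun i hi => coord_embed h x (Finset.mem_Ioc.1 hi).1
    change (x.1.1 + ∑ i ∈ Finset.Ioc n m, coord x i) + ∑ i ∈ Finset.Ioc m k, coord (embed h x) i
      = x.1.1 + ∑ i ∈ Finset.Ioc n k, coord x i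
    rw [e, add_assoc, Finset.sum_Ioc_consecutive _ h h']
  · rw [coord_embed _ _ hi, coord_embed _ _ (lt_of_le_of_lt h' hi), coord_embed _ _ hi]

variable (S)

/-- Two points of the levels are identified if they become equal in a common higher level. -/
instance levelSetoid : Setoid (Σ n, S.Level n) where
  r p q := ∃ (k : ℕ) (hp : p.1 ≤ k) (hq : q.1 ≤ k), embed hp p.2 = embed hq q.2
  iseqv :=
    { refl := fun p => ⟨p.1, le_rfl, le_rfl, rfl⟩
      symm := fun ⟨k, hp, hq, e⟩ => ⟨k, hq, hp, e.symm⟩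
      trans := by
        rintro p q r ⟨k, hp, hq, e⟩ ⟨l, hq', hr, e'⟩
        refine ⟨max k l, hp.trans (le_max_left _ _), hr.trans (le_max_right _ _), ?_⟩
        rw [← embed_embed hp (le_max_left k l), e, embed_embed,
          ← embed_embed hr (le_max_right k l), ← e', embed_embed] }

/-- The `(C,F)`-space: the inductive limit of the spaces `X_n`. -/
def Space : Type _ := Quotient S.levelSetoid

/-- The inductive limit topology. -/
instance : TopologicalSpace S.Space := inferInstanceAs (TopologicalSpace (Quotient S.levelSetoid))

instance : MeasurableSpace S.Space := borel _

instance : BorelSpace S.Space := ⟨rfl⟩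

variable {S}

/-- The canonical embedding of `X_n` into the `(C,F)`-space. -/
def incl (n : ℕ) (x : S.Level n) : S.Space := Quotient.mk S.levelSetoid ⟨n, x⟩

theorem incl_embed {n m : ℕ} (h : n ≤ m) (x : S.Level n) : incl m (embed h x) = incl n x :=
  Quotient.sound (s := S.levelSetoid) ⟨m, le_rfl, h, embed_refl _⟩

theorem exists_incl (x : S.Space) : ∃ (n : ℕ) (y : S.Level n), incl n y = x := by
  obtain ⟨⟨n, y⟩, rfl⟩ := Quotient.exists_rep x
  exact ⟨n, y, rfl⟩

/-- `(f_n, c_{n+1}, …) ↦ (g + f_n, c_{n+1}, …)`, defined when `g + f_n ∈ F_n`. -/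
def shift (g : G) {n : ℕ} (x : S.Level n) (h : g + x.1.1 ∈ S.F n) : S.Level n :=
  (⟨g + x.1.1, h⟩, x.2)

theorem shift_embed_mem {g : G} {n m : ℕ} (hnm : n ≤ m) {x : S.Level n}
    (h : g + x.1.1 ∈ S.F n) : g + (embed hnm x).1.1 ∈ S.F m := by
  have := head_mem (shift g x h) hnm
  change (g + x.1.1) + ∑ i ∈ Finset.Ioc n m, coord x i ∈ S.F m at this
  rwa [add_assoc] at this

theorem embed_shift {g : G} {n m : ℕ} (hnm : n ≤ m) {x : S.Level n} (h : g + x.1.1 ∈ S.F n) :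
    embed hnm (shift g x h) = shift g (embed hnm x) (shift_embed_mem hnm h) :=
  Prod.ext (Subtype.ext (add_assoc _ _ _)) rfl

theorem incl_shift_congr {g : G} {n m : ℕ} {x : S.Level n} {y : S.Level m}
    (hx : g + x.1.1 ∈ S.F n) (hy : g + y.1.1 ∈ S.F m) (e : incl n x = incl m y) :
    incl n (shift g x hx) = incl m (shift g y hy) := by
  obtain ⟨k, hn, hm, e⟩ := Quotient.exact e
  replace e : embed hn x = embed hm y := e
  rw [← incl_embed hn, ← incl_embed hm, embed_shift, embed_shift]
  congr 1
  have key : ∀ (u v : S.Level k) (hu : g + u.1.1 ∈ S.F k) (hv : g + v.1.1 ∈ S.F k), u = v →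
      shift g u hu = shift g v hv := by
    rintro u v hu hv rfl
    rfl
  exact key _ _ _ _ e

theorem sum_mem_sum (s : Finset ℕ) {f : ℕ → G} {t : ℕ → Finset G} (h : ∀ i ∈ s, f i ∈ t i) :
    ∑ i ∈ s, f i ∈ ∑ i ∈ s, t i := by
  induction s using Finset.induction_on with
  | empty => simp
  | insert a s ha ih =>
    rw [Finset.sum_insert ha, Finset.sum_insert ha]
    exact Finset.add_mem_add (h a (Finset.mem_insert_self a s))
      (ih fun i hi => h i (Finset.mem_insert_of_mem hi))

/-- Every point of the `(C,F)`-space lies, for each `g`, in the domain of the `g`-shift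
on some level. -/
theorem exists_shift (g : G) (x : S.Space) :
    ∃ (m : ℕ) (y : S.Level m), g + y.1.1 ∈ S.F m ∧ incl m y = x := by
  obtain ⟨n, y, rfl⟩ := exists_incl x
  obtain ⟨m, hm, hsub⟩ := S.absorb g (n + 1) n.succ_pos
  refine ⟨m, embed (n.le_succ.trans hm.le) y, ?_, incl_embed _ _⟩
  rw [← embed_embed n.le_succ hm.le]
  apply hsub
  change g + ((embed n.le_succ y).1.1 + ∑ i ∈ Finset.Ioc (n + 1) m, coord (embed n.le_succ y) i) ∈ _
  rw [← add_assoc]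
  refine Finset.add_mem_add (Finset.add_mem_add (Finset.mem_singleton_self g)
    (embed n.le_succ y).1.2) ?_
  exact sum_mem_sum _ fun i hi => coord_mem _ (Finset.mem_Ioc.1 hi).1

/-- The transformation `T_g` of the `(C,F)`-space:
`T_g (f_n, c_{n+1}, …) = (g + f_n, c_{n+1}, …)` whenever `g + f_n ∈ F_n`. -/
def translate (g : G) (x : S.Space) : S.Space :=
  incl _ (shift g (exists_shift g x).choose_spec.choose
    (exists_shift g x).choose_spec.choose_spec.1)

theorem translate_incl (g : G) {n : ℕ} (x : S.Level n) (h : g + x.1.1 ∈ S.F n) :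
    translate g (incl n x) = incl n (shift g x h) :=
  incl_shift_congr _ _ (exists_shift g (incl n x)).choose_spec.choose_spec.2

variable (S)

/-- The `(C,F)`-action of `G`. -/
instance : AddAction G S.Space where
  vadd := translate
  zero_vadd x := by
    obtain ⟨n, y, rfl⟩ := exists_incl x
    have h : (0 : G) + y.1.1 ∈ S.F n := by simpa using y.1.2
    change translate 0 (incl n y) = _
    rw [translate_incl 0 y h]
    congr 1
    exact Prod.ext (Subtype.ext (zero_add _)) rfl
  add_vadd g h x := by
    obtain ⟨n, y, hy, rfl⟩ := exists_shift h x
    obtain ⟨m, z, hz, e⟩ := exists_shift (g + h) (incl n y)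
    obtain ⟨k, hn, hm, e⟩ := Quotient.exact e
    replace e : embed hn z = embed hm y := e
    change translate (g + h) (incl n y) = translate g (translate h (incl n y))
    have h₁ : h + (embed hm y).1.1 ∈ S.F k := shift_embed_mem hm hy
    have h₂ : (g + h) + (embed hm y).1.1 ∈ S.F k := e ▸ shift_embed_mem hn hz
    have h₃ : g + (shift h (embed hm y) h₁).1.1 ∈ S.F k := by
      change g + (h + (embed hm y).1.1) ∈ S.F k
      rwa [← add_assoc]
    rw [← incl_embed hm, translate_incl _ _ h₂, translate_incl _ _ h₁, translate_incl _ _ h₃]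
    congr 1
    exact Prod.ext (Subtype.ext (add_assoc _ _ _)) rfl

/-- The `n`-cylinder `[A]_n = {(f_n, c_{n+1}, …) ∈ X_n | f_n ∈ A}`. -/
def cyl (n : ℕ) (A : Finset G) : Set S.Space := incl n '' {x : S.Level n | x.1.1 ∈ A}

/-- The cylinders are the sets `[A]_n` with `A ⊆ F_n`. -/
def IsCylinder (A : Set S.Space) : Prop := ∃ (n : ℕ) (A' : Finset G), A' ⊆ S.F n ∧ A = S.cyl n A'

instance nonempty_letter {n : ℕ} (i : Set.Ioi n) : Nonempty (Letter (S.C i)) := by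
  have h : 1 < (S.C i).card := S.one_lt_card_C i (lt_of_le_of_lt (Nat.zero_le n) i.2)
  obtain ⟨g, hg⟩ := Finset.card_pos.1 (zero_lt_one.trans h)
  exact ⟨⟨g, hg⟩⟩

/-- The measure on `X_n`: the product of the counting measure on `F_n` and the uniform
probability measures on `C_{n+1}, C_{n+2}, …`, divided by `#C_1 ⋯ #C_n`. -/
def levelMeasure (n : ℕ) : Measure (S.Level n) :=
  ((∏ i ∈ Finset.Ioc 0 n, (S.C i).card : ℕ) : ENNReal)⁻¹ •
    (Measure.count : Measure (Letter (S.F n))).prod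
      (Measure.infinitePi fun i : Set.Ioi n =>
        ProbabilityTheory.uniformOn (Set.univ : Set (Letter (S.C i))))

/-- The `(C,F)`-measure on the `(C,F)`-space: the supremum of the increasing sequence of the
measures on `X_0 ⊆ X_1 ⊆ ⋯`.  It gives each `[A]_n`, `A ⊆ F_n`, the mass
`#A / (#C_1 ⋯ #C_n)`. -/
def measure : Measure S.Space := ⨆ n, (S.levelMeasure n).map (incl n)

/-- The ratio
`∑_{g ∈ F_n - F_n} μ(A ∩ T_g B) / ∑_{g ∈ F_n - F_n} μ([0]_0 ∩ T_g [0]_0)`. -/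
def returnRatio (A B : Set S.Space) (n : ℕ) : ℝ :=
  (∑ g ∈ S.F n - S.F n, S.measure.real (A ∩ (g +ᵥ B))) /
    ∑ g ∈ S.F n - S.F n, S.measure.real (S.cyl 0 {0} ∩ (g +ᵥ S.cyl 0 {0}))

/-- The ratios converge to `μ(A) μ(B)` for all cylinders `A, B ⊆ [0]_0`. -/
def CylinderRatioCondition : Prop :=
  ∀ A B : Set S.Space, S.IsCylinder A → S.IsCylinder B → A ⊆ S.cyl 0 {0} → B ⊆ S.cyl 0 {0} →
    Tendsto (S.returnRatio A B) atTop (𝓝 (S.measure.real A * S.measure.real B))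

/-- For all `l > 0` and `h ∈ F_l - F_l`, the sums of `μ([0]_l ∩ T_g [0]_l)` over
`g ∈ F_n - F_n + h` and over `g ∈ F_n - F_n` are asymptotically equivalent. -/
def ShiftCondition : Prop :=
  ∀ l, 0 < l → ∀ h ∈ S.F l - S.F l,
    (fun n => ∑ g ∈ S.F n - S.F n + {h}, S.measure.real (S.cyl l {0} ∩ (g +ᵥ S.cyl l {0})))
      ~[atTop]
    (fun n => ∑ g ∈ S.F n - S.F n, S.measure.real (S.cyl l {0} ∩ (g +ᵥ S.cyl l {0})))

/-- The value `(ν_D * ν_{-D})(E)`, where `ν_D = ∑_{g ∈ D} δ_g` and `*` is the convolution of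
measures on the discrete group `G`. -/
def autoconv (D E : Finset G) : ℝ :=
  letI : MeasurableSpace G := ⊤
  (Measure.conv (∑ g ∈ D, Measure.dirac g) (∑ g ∈ -D, Measure.dirac g)).real (E : Set G)

/-- For all `l > 0` and `h ∈ F_l - F_l`, with `D = C_{l+1} + ⋯ + C_L`, the iterated limit,
as `L → ∞` and then `n → ∞`, of
`(ν_D * ν_{-D})(F_n - F_n) / (ν_D * ν_{-D})(F_n - F_n + h)` equals `1`.
The inner limit is required to exist for all large `n`. -/
def ConvolutionCondition : Prop :=
  ∀ l, 0 < l → ∀ h ∈ S.F l - S.F l, ∃ r : ℕ → ℝ,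
    (∀ᶠ n in atTop, Tendsto (fun L =>
      autoconv (∑ i ∈ Finset.Ioc l L, S.C i) (S.F n - S.F n) /
        autoconv (∑ i ∈ Finset.Ioc l L, S.C i) (S.F n - S.F n + {h})) atTop (𝓝 (r n))) ∧
    Tendsto r atTop (𝓝 1)

end CFSequence

/-- Weak rational ergodicity, along an increasing sequence `(S_n)` of finite subsets of an Abelian
group, of an ergodic conservative measure preserving action on a σ-finite measure space. The
defining limit makes sense for every such sequence, Følner or not. -/
structure IsWeaklyRationallyErgodicAlong {G X : Type*} [AddCommGroup G] [AddAction G X]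
    [MeasurableSpace X] (μ : Measure X) (S : ℕ → Finset G) : Prop where
  sigmaFinite : SigmaFinite μ
  /-- the action preserves `μ` and is ergodic -/
  ergodic : ErgodicVAdd G X μ
  /-- there is no wandering set of positive measure -/
  conservative : ∀ A : Set X, MeasurableSet A → μ A ≠ 0 → ∃ g : G, g ≠ 0 ∧ μ (A ∩ (g +ᵥ A)) ≠ 0
  monotone : Monotone S
  exists_set : ∃ Y : Set X, MeasurableSet Y ∧ 0 < μ Y ∧ μ Y < ⊤ ∧
    ∀ A B : Set X, MeasurableSet A → MeasurableSet B → A ⊆ Y → B ⊆ Y →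
      Tendsto (fun n => (1 / ∑ g ∈ S n, μ.real (Y ∩ (g +ᵥ Y)) / μ.real Y ^ 2) *
        ∑ g ∈ S n, μ.real (A ∩ (g +ᵥ B))) atTop (𝓝 (μ.real A * μ.real B))

/-- A nonsingular transformation of a measure space: a measurable map, invertible modulo null
sets, such that it and its inverse pull null sets back to null sets. -/
def IsNonsingularTransformation {X : Type*} [MeasurableSpace X] (μ : Measure X) (Q : X → X) :
    Prop :=
  Measure.QuasiMeasurePreserving Q μ μ ∧
    ∃ R : X → X, Measure.QuasiMeasurePreserving R μ μ ∧ R ∘ Q =ᵐ[μ] id ∧ Q ∘ R =ᵐ[μ] id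

/-- An action is non-squashable if every nonsingular transformation that commutes with the action
(almost everywhere) preserves the measure. -/
def IsNonSquashable (G : Type*) {X : Type*} [AddCommGroup G] [AddAction G X] [MeasurableSpace X]
    (μ : Measure X) : Prop :=
  ∀ Q : X → X, IsNonsingularTransformation μ Q →
    (∀ g : G, ∀ᵐ x ∂μ, Q (g +ᵥ x) = g +ᵥ Q x) → MeasurePreserving Q μ μ

end

/-! Everything is measured against the base `X_0`, of mass 1, with `a_n` its return sum over `S_n =
F_n - F_n`.

The three alternatives reduce to the first. For (iii), the convolution mass divided by `#C_1 ⋯ #C_L`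
counts `L`-cylinders inside `[0]_l ∩ T_g [0]_l`; these increase to the whole intersection, so the
inner limit is a ratio of return sums and (iii) is (ii) in disguise. For (ii), write two cylinders
at a common level `l`. Since `[a]_l` is the `a`-translate of `[0]_l`, the return sum of `[a]_l` and
`[b]_l` over `S_n` is that of `[0]_l` with itself over `S_n + (b - a)`. All pairs `(a, b)` thus
contribute asymptotically equally, and the ratio only sees cardinalities.

The passage from cylinders to Borel sets (`tendsto_returnRatio`) is an approximation in measure. It
needs the bound, uniform in `n`, that the return sum of `A` against the base is at most `K^3 a_n
μ(A)` (`returnSum_base_le_mul`). A packing argument (`card_returns_mul_le`) together with the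
covering hypothesis shows that an orbit visits the base at most `K^3 #C_1 ⋯ #C_n` times along `S_n`,
while `a_n` is at least `#C_1 ⋯ #C_n`.

Ergodicity follows from uniqueness (`eq_smul_measure`): an invariant measure finite on the base is a
multiple of `μ`, because all `[f]_n` with `n` fixed are translates of each other. Conservativity
adds the absence of atoms. The set `Y` is the base.

For non-squashability, the image of `μ` under `Q` is invariant, σ-finite and absolutely continuous,
hence equal to `c • μ`. Transporting a small set by `Q` multiplies its return ratios by `c`, whereas
the limit law makes them quadratic in its measure. So `c = c ^ 2`, and `c = 1`. -/

noncomputable section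

namespace CFSequence

variable {G : Type*} [AddCommGroup G] [DecidableEq G] {S : CFSequence G}

/-! ### Cylinders -/

/-- The point of `X_n` with given head and coordinates. -/
def ofCoords {n : ℕ} (a : G) (ha : a ∈ S.F n) (f : ℕ → G) (hf : ∀ i, n < i → f i ∈ S.C i) :
    S.Level n :=
  (⟨a, ha⟩, fun i => ⟨f i, hf i i.2⟩)

theorem coord_ofCoords {n : ℕ} {a : G} {ha : a ∈ S.F n} {f : ℕ → G}
    {hf : ∀ i, n < i → f i ∈ S.C i} {i : ℕ} (hi : n < i) :
    coord (ofCoords a ha f hf) i = f i := by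
  simp [coord, ofCoords, hi]

variable (S) in
/-- The sum `C_{n+1} + ⋯ + C_m`. -/
def tailSum (n m : ℕ) : Finset G := ∑ i ∈ Finset.Ioc n m, S.C i

theorem tailSum_self (n : ℕ) : S.tailSum n n = 0 := by simp [tailSum]

theorem tailSum_succ {n m : ℕ} (h : n ≤ m) :
    S.tailSum n (m + 1) = S.tailSum n m + S.C (m + 1) :=
  Finset.sum_Ioc_succ_top h _

theorem tailSum_add {n m k : ℕ} (h : n ≤ m) (h' : m ≤ k) :
    S.tailSum n m + S.tailSum m k = S.tailSum n k :=
  Finset.sum_Ioc_consecutive _ h h'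

theorem sum_coord_mem_tailSum {n : ℕ} (x : S.Level n) {l m : ℕ} (h : n ≤ l) :
    ∑ i ∈ Finset.Ioc l m, coord x i ∈ S.tailSum l m :=
  sum_mem_sum _ fun _ hi => coord_mem _ (h.trans_lt (Finset.mem_Ioc.1 hi).1)

theorem add_tailSum_subset {n m : ℕ} (h : n ≤ m) {A : Finset G} (hA : A ⊆ S.F n) :
    A + S.tailSum n m ⊆ S.F m := by
  induction m, h using Nat.le_induction with
  | base =>
    rwa [tailSum_self, add_zero]
  | succ m h ih =>
    rw [tailSum_succ h, ← add_assoc]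
    exact (Finset.add_subset_add_right ih).trans (S.add_subset m)

theorem add_eq_add_iff {n : ℕ} {a a' c c' : G} (ha : a ∈ S.F n) (ha' : a' ∈ S.F n)
    (hc : c ∈ S.C (n + 1)) (hc' : c' ∈ S.C (n + 1)) (e : a + c = a' + c') : a = a' ∧ c = c' := by
  by_cases h : c = c'
  · subst h
    exact ⟨add_right_cancel e, rfl⟩
  · refine absurd (S.disjoint n c hc c' hc' h) (Finset.not_disjoint_iff.2 ⟨a + c, ?_, ?_⟩)
    · exact Finset.add_mem_add ha (Finset.mem_singleton_self c)
    · rw [e]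
      exact Finset.add_mem_add ha' (Finset.mem_singleton_self c')

/-- Disjointness of the translates of `F_m` lets the last summand be peeled off uniquely, so a head
at level `m` encodes the whole word `f_n, c_{n+1}, …, c_m`. -/
theorem eq_of_embed_head_eq {n m : ℕ} (h : n ≤ m) {x y : S.Level n}
    (e : (embed h x).1.1 = (embed h y).1.1) :
    x.1.1 = y.1.1 ∧ ∀ i, n < i → i ≤ m → coord x i = coord y i := by
  change x.1.1 + ∑ i ∈ Finset.Ioc n m, coord x i = y.1.1 + ∑ i ∈ Finset.Ioc n m, coord y i at e
  induction m, h using Nat.le_induction with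
  | base => exact ⟨by simpa using e, fun i hi hi' => absurd hi' hi.not_ge⟩
  | succ m h ih =>
    rw [Finset.sum_Ioc_succ_top h, Finset.sum_Ioc_succ_top h, ← add_assoc, ← add_assoc] at e
    obtain ⟨e₁, e₂⟩ := add_eq_add_iff (head_mem x h) (head_mem y h)
      (coord_mem x (Nat.lt_succ_of_le h)) (coord_mem y (Nat.lt_succ_of_le h)) e
    obtain ⟨e₃, e₄⟩ := ih e₁
    refine ⟨e₃, fun i hi hi' => ?_⟩
    rcases Nat.le_succ_iff.1 hi' with hi' | rfl
    · exact e₄ i hi hi'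
    · exact e₂

theorem embed_injective {n m : ℕ} (h : n ≤ m) :
    Function.Injective (embed h : S.Level n → S.Level m) := by
  intro x y e
  obtain ⟨e₁, e₂⟩ := eq_of_embed_head_eq h (x := x) (y := y) (by rw [e])
  refine level_ext e₁ fun i hi => ?_
  rcases le_or_gt i m with him | him
  · exact e₂ i hi him
  · rw [← coord_embed h x him, e, coord_embed h y him]

theorem incl_injective (n : ℕ) : Function.Injective (incl n : S.Level n → S.Space) := by
  intro x y e
  obtain ⟨k, hx, hy, e⟩ := Quotient.exact e
  exact embed_injective hx e

theorem incl_mem_cyl {n : ℕ} {x : S.Level n} {A : Finset G} :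
    incl n x ∈ S.cyl n A ↔ x.1.1 ∈ A :=
  ⟨fun ⟨_, hy, e⟩ => incl_injective n e ▸ hy, fun h => ⟨x, h, rfl⟩⟩

/-- A point of `X_m` whose head agrees with that of the image of `y ∈ X_n` comes from `X_n`. -/
theorem exists_embed_eq {n m : ℕ} (h : n ≤ m) (y : S.Level n) (z : S.Level m)
    (e : z.1.1 = (embed h y).1.1) :
    ∃ w : S.Level n, embed h w = z ∧ w.1 = y.1 ∧ ∀ i, n < i → i ≤ m → coord w i = coord y i := by
  have hf : ∀ i, n < i → (if i ≤ m then coord y i else coord z i) ∈ S.C i := by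
    intro i hi
    split_ifs with him
    · exact coord_mem y hi
    · exact coord_mem z (not_le.1 him)
  have hw : ∀ i, n < i → i ≤ m → coord (ofCoords y.1.1 y.1.2 _ hf) i = coord y i := by
    intro i hi him
    rw [coord_ofCoords hi, if_pos him]
  refine ⟨ofCoords y.1.1 y.1.2 _ hf, level_ext ?_ fun i hi => ?_, rfl, hw⟩
  · rw [e]
    change y.1.1 + ∑ i ∈ Finset.Ioc n m, coord (ofCoords y.1.1 y.1.2 _ hf) i = y.1.1 + _
    rw [Finset.sum_congr rfl fun i hi => hw i (Finset.mem_Ioc.1 hi).1 (Finset.mem_Ioc.1 hi).2]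
  · rw [coord_embed h _ hi, coord_ofCoords (h.trans_lt hi), if_neg hi.not_ge]

theorem nonempty_C {n : ℕ} (hn : 0 < n) : (S.C n).Nonempty :=
  Finset.card_pos.1 (zero_lt_one.trans (S.one_lt_card_C n hn))

theorem cyl_succ {n : ℕ} {A : Finset G} (hA : A ⊆ S.F n) :
    S.cyl n A = S.cyl (n + 1) (A + S.C (n + 1)) := by
  ext x
  constructor
  · rintro ⟨y, hy, rfl⟩
    rw [← incl_embed n.le_succ, incl_mem_cyl]
    refine Finset.add_mem_add hy ?_
    simpa using coord_mem y n.lt_succ_self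
  · rintro ⟨z, hz, rfl⟩
    obtain ⟨a, ha, c, hc, e⟩ := Finset.mem_add.1 hz
    have hf : ∀ i, n < i → (if i = n + 1 then c else coord z i) ∈ S.C i := by
      intro i hi
      split_ifs with him
      · rwa [him]
      · exact coord_mem z (lt_of_le_of_ne hi (Ne.symm him))
    obtain ⟨w, hw, hw', -⟩ := exists_embed_eq n.le_succ (ofCoords a (hA ha) _ hf) z (by
      rw [← e]
      change a + c = a + _
      simp [coord_ofCoords])
    rw [← hw, incl_embed, incl_mem_cyl, hw']
    exact ha

theorem cyl_eq_cyl {n m : ℕ} (h : n ≤ m) {A : Finset G} (hA : A ⊆ S.F n) :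
    S.cyl n A = S.cyl m (A + S.tailSum n m) := by
  induction m, h using Nat.le_induction with
  | base =>
    rw [tailSum_self, add_zero]
  | succ m h ih => rw [ih, cyl_succ (add_tailSum_subset h hA), tailSum_succ h, add_assoc]

theorem cyl_empty (n : ℕ) : S.cyl n ∅ = ∅ := by simp [cyl]

theorem cyl_inter (n : ℕ) (A B : Finset G) : S.cyl n A ∩ S.cyl n B = S.cyl n (A ∩ B) := by
  rw [cyl, cyl, ← Set.image_inter (incl_injective n)]
  simp only [cyl, Finset.mem_inter]
  rfl

theorem cyl_union (n : ℕ) (A B : Finset G) : S.cyl n A ∪ S.cyl n B = S.cyl n (A ∪ B) := by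
  rw [cyl, cyl, ← Set.image_union]
  simp only [cyl, Finset.mem_union]
  rfl

theorem cyl_sdiff (n : ℕ) (A B : Finset G) : S.cyl n A \ S.cyl n B = S.cyl n (A \ B) := by
  rw [cyl, cyl, ← Set.image_sdiff (incl_injective n)]
  simp only [cyl, Finset.mem_sdiff]
  rfl

theorem cyl_mono {n : ℕ} {A B : Finset G} (h : A ⊆ B) : S.cyl n A ⊆ S.cyl n B :=
  Set.image_mono fun _ hx => h hx

theorem cyl_eq_biUnion (n : ℕ) (A : Finset G) : S.cyl n A = ⋃ a ∈ A, S.cyl n {a} := by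
  ext x
  simp [cyl]

theorem pairwiseDisjoint_cyl (n : ℕ) (A : Set G) :
    A.PairwiseDisjoint fun a => S.cyl n {a} := by
  intro a _ b _ hab
  rw [Function.onFun, Set.disjoint_iff_inter_eq_empty, cyl_inter, ← cyl_empty n]
  congr 1
  exact Finset.singleton_inter_of_notMem (by simpa using hab)

theorem monotone_cyl_F : Monotone fun n => S.cyl n (S.F n) := by
  intro n m h
  simp only
  rw [cyl_eq_cyl h subset_rfl]
  exact cyl_mono (add_tailSum_subset h subset_rfl)

theorem iUnion_cyl_F : ⋃ n, S.cyl n (S.F n) = Set.univ := by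
  refine Set.eq_univ_of_forall fun x => ?_
  obtain ⟨n, y, rfl⟩ := exists_incl x
  exact Set.mem_iUnion.2 ⟨n, incl_mem_cyl.2 y.1.2⟩

/-! ### Translates of cylinders -/

theorem vadd_incl (g : G) {n : ℕ} (x : S.Level n) (h : g + x.1.1 ∈ S.F n) :
    g +ᵥ incl n x = incl n (shift g x h) :=
  translate_incl g x h

theorem vadd_cyl_subset (g : G) {n : ℕ} {A : Finset G} (h : {g} + A ⊆ S.F n) :
    g +ᵥ S.cyl n A ⊆ S.cyl n ({g} + A) := by
  rintro _ ⟨_, ⟨x, hx, rfl⟩, rfl⟩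
  have hgx : g + x.1.1 ∈ {g} + A := Finset.add_mem_add (Finset.mem_singleton_self g) hx
  simp only
  rw [vadd_incl g x (h hgx), incl_mem_cyl]
  exact hgx

theorem vadd_cyl (g : G) {n : ℕ} {A : Finset G} (hA : A ⊆ S.F n) (h : {g} + A ⊆ S.F n) :
    g +ᵥ S.cyl n A = S.cyl n ({g} + A) := by
  refine (vadd_cyl_subset g h).antisymm ?_
  have e : {-g} + ({g} + A) = A := by
    rw [← add_assoc, Finset.singleton_add_singleton, neg_add_cancel]
    exact zero_add A
  have := vadd_cyl_subset (S := S) (-g) (n := n) (A := {g} + A) (by rwa [e])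
  rw [e] at this
  rwa [Set.subset_vadd_set_iff]

theorem vadd_cyl_singleton {n : ℕ} {f f' : G} (hf : f ∈ S.F n) (hf' : f' ∈ S.F n) :
    (f' - f) +ᵥ S.cyl n {f} = S.cyl n {f'} := by
  rw [vadd_cyl _ (by simpa using hf)] <;> simp [hf']

theorem exists_absorb (g : G) {n : ℕ} {A : Finset G} (hA : A ⊆ S.F n) (N : ℕ) :
    ∃ m, n ≤ m ∧ N ≤ m ∧ {g} + (A + S.tailSum n m) ⊆ S.F m := by
  -- The absorption axiom starts at positive levels, hence `N + 1` rather than `N`.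
  have hn : n ≤ max n (N + 1) := le_max_left _ _
  have hN : N + 1 ≤ max n (N + 1) := le_max_right _ _
  obtain ⟨m, hm, h⟩ := S.absorb g (max n (N + 1)) (by omega)
  refine ⟨m, by omega, by omega, subset_trans ?_ h⟩
  rw [← tailSum_add hn hm.le, ← add_assoc A, ← add_assoc]
  exact Finset.add_subset_add_right (Finset.add_subset_add_left (add_tailSum_subset hn hA))

theorem exists_vadd_cyl_eq (g : G) {n : ℕ} {A : Finset G} (hA : A ⊆ S.F n) (N : ℕ) :
    ∃ m, n ≤ m ∧ N ≤ m ∧ {g} + (A + S.tailSum n m) ⊆ S.F m ∧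
      g +ᵥ S.cyl n A = S.cyl m ({g} + (A + S.tailSum n m)) := by
  obtain ⟨m, hn, hN, h⟩ := exists_absorb (S := S) g hA N
  exact ⟨m, hn, hN, h, by rw [cyl_eq_cyl hn hA, vadd_cyl g (add_tailSum_subset hn hA) h]⟩

/-! ### Cardinalities -/

variable (S) in
/-- The product `#C_1 ⋯ #C_n`. -/
def size (n : ℕ) : ℕ := ∏ i ∈ Finset.Ioc 0 n, (S.C i).card

theorem size_zero : S.size 0 = 1 := by simp [size]

theorem size_succ (n : ℕ) : S.size (n + 1) = S.size n * (S.C (n + 1)).card :=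
  Finset.prod_Ioc_succ_top (Nat.zero_le n) _

theorem size_pos (n : ℕ) : 0 < S.size n :=
  Finset.prod_pos fun i hi => zero_lt_one.trans (S.one_lt_card_C i (Finset.mem_Ioc.1 hi).1)

theorem two_pow_le_size (n : ℕ) : 2 ^ n ≤ S.size n := by
  induction n with
  | zero => simp [size_zero]
  | succ n ih =>
    rw [size_succ, pow_succ]
    exact Nat.mul_le_mul ih (S.one_lt_card_C _ n.succ_pos)

theorem card_add_tailSum {n m : ℕ} (h : n ≤ m) {A : Finset G} (hA : A ⊆ S.F n) :
    (A + S.tailSum n m).card * S.size n = A.card * S.size m := by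
  induction m, h using Nat.le_induction with
  | base =>
    rw [tailSum_self, add_zero]
  | succ m h ih =>
    have : (A + S.tailSum n m + S.C (m + 1)).card
        = (A + S.tailSum n m).card * (S.C (m + 1)).card := by
      refine Finset.card_add_iff.2 ?_
      rintro ⟨a, c⟩ ⟨ha, hc⟩ ⟨a', c'⟩ ⟨ha', hc'⟩ e
      obtain ⟨rfl, rfl⟩ := add_eq_add_iff (add_tailSum_subset h hA ha)
        (add_tailSum_subset h hA ha') hc hc' e
      rfl
    rw [tailSum_succ h, ← add_assoc, this, size_succ, mul_right_comm, ih, mul_assoc]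

/-! ### Topology -/

theorem isOpen_iff {U : Set S.Space} : IsOpen U ↔ ∀ n, IsOpen (incl n ⁻¹' U : Set (S.Level n)) := by
  refine (isQuotientMap_quotient_mk' (s := S.levelSetoid)).isOpen_preimage.symm.trans ?_
  exact isOpen_sigma_iff

theorem continuous_incl (n : ℕ) : Continuous (incl n : S.Level n → S.Space) :=
  ⟨fun _ hU => isOpen_iff.1 hU n⟩

theorem isOpen_preimage_cyl_self (n : ℕ) (A : Finset G) :
    IsOpen (incl n ⁻¹' S.cyl n A : Set (S.Level n)) := by
  have : (incl n ⁻¹' S.cyl n A : Set (S.Level n)) = Prod.fst ⁻¹' {a | a.1 ∈ A} := by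
    ext x
    exact incl_mem_cyl
  rw [this]
  exact (isOpen_discrete _).preimage continuous_fst

/-- The new head depends only on the old head and the finitely many coordinates up to `m`, so it is
locally constant. -/
theorem continuous_embed {n m : ℕ} (h : n ≤ m) :
    Continuous (embed h : S.Level n → S.Level m) := by
  refine Continuous.prodMk ?_ (by fun_prop)
  refine (IsLocallyConstant.iff_exists_open _).2 (fun x => ?_) |>.continuous
  refine ⟨{y | y.1 = x.1} ∩ ⋂ i ∈ {i : Set.Ioi n | (i : ℕ) ≤ m}, {y | y.2 i = x.2 i},
    IsOpen.inter ?_ (Set.Finite.isOpen_biInter ?_ fun i _ => ?_), by simp, fun y hy => ?_⟩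
  · exact (isOpen_discrete {x.1}).preimage continuous_fst
  · exact Set.Finite.preimage Subtype.val_injective.injOn (Set.finite_Iic m)
  · exact isOpen_discrete {a | a = x.2 i} |>.preimage
      (f := fun y : S.Level n => y.2 i) (by fun_prop)
  · refine Subtype.ext ?_
    change y.1.1 + _ = x.1.1 + _
    rw [show y.1 = x.1 from hy.1]
    congr 1
    refine Finset.sum_congr rfl fun i hi => ?_
    obtain ⟨hi, him⟩ := Finset.mem_Ioc.1 hi
    have : y.2 ⟨i, hi⟩ = x.2 ⟨i, hi⟩ := Set.mem_iInter₂.1 hy.2 ⟨i, hi⟩ him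
    simp [coord, hi, this]

theorem isOpen_cyl {n : ℕ} {A : Finset G} (hA : A ⊆ S.F n) : IsOpen (S.cyl n A) := by
  refine isOpen_iff.2 fun m => ?_
  rcases le_total m n with h | h
  · have : (incl m ⁻¹' S.cyl n A : Set (S.Level m)) = embed h ⁻¹' (incl n ⁻¹' S.cyl n A) := by
      ext x
      simp [incl_embed]
    rw [this]
    exact (isOpen_preimage_cyl_self n A).preimage (continuous_embed h)
  · rw [cyl_eq_cyl h hA]
    exact isOpen_preimage_cyl_self m _

variable (S) in
/-- The cylinders `[f]_n`, `f ∈ F_n`, of level at least `N`. -/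
def pointCylinders (N : ℕ) : Set (Set S.Space) :=
  {A | ∃ n, N ≤ n ∧ ∃ f ∈ S.F n, A = S.cyl n {f}}

/-- A basic neighbourhood in `X_n` constrains finitely many coordinates. Beyond the last of them,
fixing the head fixes them all. -/
theorem isTopologicalBasis_pointCylinders (N : ℕ) :
    TopologicalSpace.IsTopologicalBasis (S.pointCylinders N) := by
  refine TopologicalSpace.isTopologicalBasis_of_isOpen_of_nhds ?_ ?_
  · rintro _ ⟨n, -, f, hf, rfl⟩
    exact isOpen_cyl (by simpa using hf)
  · intro x U hx hU
    obtain ⟨n, y, rfl⟩ := exists_incl x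
    have hy : incl n ⁻¹' U ∈ 𝓝 y := (isOpen_iff.1 hU n).mem_nhds hx
    obtain ⟨u, hu, v, hv, huv⟩ := mem_nhds_prod_iff.1 hy
    rw [nhds_pi, Filter.mem_pi] at hv
    obtain ⟨I, hI, t, ht, htv⟩ := hv
    obtain ⟨M, hM⟩ := (hI.image Subtype.val).bddAbove
    have hnm : n ≤ max (max n N) M := (le_max_left _ _).trans (le_max_left _ _)
    refine ⟨_, ⟨max (max n N) M, (le_max_right _ _).trans (le_max_left _ _), _,
      (embed hnm y).1.2, rfl⟩, ?_, ?_⟩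
    · rw [← incl_embed hnm, incl_mem_cyl]
      exact Finset.mem_singleton_self _
    · rintro _ ⟨z, hz, rfl⟩
      obtain ⟨w, rfl, hw, hw'⟩ := exists_embed_eq hnm y z (Finset.mem_singleton.1 hz)
      rw [incl_embed]
      refine huv ⟨?_, htv fun i hi => ?_⟩
      · rw [hw]
        exact mem_of_mem_nhds hu
      · have := hw' i i.2 ((hM ⟨i, hi, rfl⟩).trans (le_max_right _ _))
        have hi' : n < (i : ℕ) := i.2
        have e : w.2 i = y.2 i := Subtype.ext (by simpa [coord, hi'] using this)
        rw [e]
        exact mem_of_mem_nhds (ht i)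

theorem countable_pointCylinders (N : ℕ) : (S.pointCylinders N).Countable := by
  have : S.pointCylinders N ⊆ ⋃ n, (fun f => S.cyl n {f}) '' (S.F n : Set G) := by
    rintro _ ⟨n, -, f, hf, rfl⟩
    exact Set.mem_iUnion.2 ⟨n, f, hf, rfl⟩
  exact (Set.countable_iUnion fun n => (S.F n).countable_toSet.image _).mono this

instance : SecondCountableTopology S.Space :=
  (isTopologicalBasis_pointCylinders 0).secondCountableTopology (countable_pointCylinders 0)

theorem generateFrom_pointCylinders (N : ℕ) :
    (inferInstance : MeasurableSpace S.Space)
      = MeasurableSpace.generateFrom (S.pointCylinders N) := by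
  rw [← (isTopologicalBasis_pointCylinders N).borel_eq_generateFrom]
  exact BorelSpace.measurable_eq

theorem measurableSet_cyl {n : ℕ} {A : Finset G} (hA : A ⊆ S.F n) : MeasurableSet (S.cyl n A) :=
  (isOpen_cyl hA).measurableSet

theorem sUnion_pointCylinders (N : ℕ) : ⋃₀ S.pointCylinders N = Set.univ :=
  (isTopologicalBasis_pointCylinders N).sUnion_eq

/-- Two such cylinders are nested or disjoint, since the coarser one is a union of singleton
cylinders of the finer level. -/
theorem isPiSystem_pointCylinders (N : ℕ) : IsPiSystem (S.pointCylinders N) := by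
  have key : ∀ n m (f g : G), n ≤ m → f ∈ S.F n → (S.cyl n {f} ∩ S.cyl m {g}).Nonempty →
      S.cyl n {f} ∩ S.cyl m {g} = S.cyl m {g} := by
    intro n m f g h hf hne
    rw [cyl_eq_cyl h (by simpa using hf), cyl_inter] at hne ⊢
    congr 1
    refine Finset.inter_eq_right.2 (Finset.singleton_subset_iff.2 ?_)
    obtain ⟨_, ⟨x, hx, -⟩⟩ := hne
    rw [Set.mem_ofPred_eq, Finset.mem_inter, Finset.mem_singleton] at hx
    exact hx.2 ▸ hx.1
  rintro _ ⟨n, hn, f, hf, rfl⟩ _ ⟨m, hm, g, hg, rfl⟩ hne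
  rcases le_total n m with h | h
  · exact ⟨m, hm, g, hg, key n m f g h hf hne⟩
  · rw [Set.inter_comm] at hne ⊢
    exact ⟨n, hn, f, hf, key m n g f h hg hne⟩

/-- Measures that are finite and agree on the cylinders `[f]_n`, `f ∈ F_n`, `n ≥ N`, are equal. -/
theorem measure_ext (N : ℕ) {μ ν : Measure S.Space}
    (hfin : ∀ n, N ≤ n → ∀ f ∈ S.F n, μ (S.cyl n {f}) ≠ ⊤)
    (h : ∀ n, N ≤ n → ∀ f ∈ S.F n, μ (S.cyl n {f}) = ν (S.cyl n {f})) : μ = ν := by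
  refine Measure.ext_of_generateFrom_of_cover_subset (generateFrom_pointCylinders N)
    (isPiSystem_pointCylinders N) subset_rfl (countable_pointCylinders N)
    (sUnion_pointCylinders N) ?_ ?_
  · rintro _ ⟨n, hn, f, hf, rfl⟩
    exact hfin n hn f hf
  · rintro _ ⟨n, hn, f, hf, rfl⟩
    exact h n hn f hf

instance : ContinuousConstVAdd G S.Space := by
  refine ⟨fun g => (isTopologicalBasis_pointCylinders 0).continuous_iff.2 ?_⟩
  rintro _ ⟨n, -, f, hf, rfl⟩
  have hf' : {f} ⊆ S.F n := by simpa using hf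
  obtain ⟨m, -, -, h, e⟩ := exists_vadd_cyl_eq (S := S) (-g) hf' 0
  rw [Set.preimage_vadd, e]
  exact isOpen_cyl h

instance : MeasurableConstVAdd G S.Space :=
  ⟨fun g => (continuous_const_vadd g).measurable⟩

/-! ### The measure -/

theorem uniformOn_singleton_letter (n : ℕ) (i : Set.Ioi n) (c : Letter (S.C i)) :
    ProbabilityTheory.uniformOn (Set.univ : Set (Letter (S.C i))) {c}
      = ((S.C i).card : ENNReal)⁻¹ := by
  let _ : Fintype (Letter (S.C i)) := inferInstanceAs (Fintype {g : G // g ∈ S.C i})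
  have : Fintype.card (Letter (S.C i)) = (S.C i).card := Fintype.card_coe _
  rw [ProbabilityTheory.uniformOn_univ, Measure.count_singleton, this, one_div]

theorem size_mul_prod {n m : ℕ} (h : n ≤ m) :
    S.size n * ∏ i ∈ Finset.Ioc n m, (S.C i).card = S.size m :=
  Finset.prod_Ioc_consecutive _ (Nat.zero_le n) h

/-- The pieces of `X_n` with given head and coordinates up to `m` have mass `1 / (#C_1 ⋯ #C_m)`. -/
theorem levelMeasure_embed_head {n m : ℕ} (h : n ≤ m) (y : S.Level n) :
    S.levelMeasure n {x | (embed h x).1.1 = (embed h y).1.1} = (S.size m : ENNReal)⁻¹ := by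
  -- Unique decomposition turns the condition on the head into a finite-dimensional box, whose mass
  -- is a product.
  have hset : {x : S.Level n | (embed h x).1.1 = (embed h y).1.1} = {y.1} ×ˢ
      Set.pi ((Finset.Ioc n m).subtype (· ∈ Set.Ioi n) : Finset (Set.Ioi n))
        (fun i => {y.2 i}) := by
    ext x
    constructor
    · intro e
      obtain ⟨e₁, e₂⟩ := eq_of_embed_head_eq h e
      refine ⟨Subtype.ext e₁, fun i hi => ?_⟩
      have hi' : n < (i : ℕ) := i.2
      have := e₂ i hi' (Finset.mem_Ioc.1 (Finset.mem_subtype.1 hi)).2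
      exact Subtype.ext (by simpa [coord, hi'] using this)
    · rintro ⟨e₁, e₂⟩
      change x.1.1 + _ = y.1.1 + _
      rw [show x.1 = y.1 from e₁]
      congr 1
      refine Finset.sum_congr rfl fun i hi => ?_
      have hi' := (Finset.mem_Ioc.1 hi).1
      have : x.2 ⟨i, hi'⟩ = y.2 ⟨i, hi'⟩ := e₂ ⟨i, hi'⟩ (by simpa using hi)
      simp [coord, hi', this]
  rw [hset, levelMeasure, Measure.smul_apply, Measure.prod_prod, Measure.count_singleton,
    Measure.infinitePi_pi _ (fun _ _ => measurableSet_singleton _), one_mul, smul_eq_mul,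
    Finset.prod_congr rfl fun i _ => uniformOn_singleton_letter n i (y.2 i)]
  have : ∏ i ∈ (Finset.Ioc n m).subtype (· ∈ Set.Ioi n), ((S.C i).card : ENNReal)⁻¹
      = ∏ i ∈ Finset.Ioc n m, ((S.C i).card : ENNReal)⁻¹ := by
    refine Finset.prod_subtype_of_mem (fun i => ((S.C i).card : ENNReal)⁻¹) fun i hi => ?_
    exact (Finset.mem_Ioc.1 hi).1
  have hprod : ((∏ i ∈ Finset.Ioc n m, (S.C i).card : ℕ) : ENNReal)⁻¹
      = ∏ i ∈ Finset.Ioc n m, ((S.C i).card : ENNReal)⁻¹ := by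
    rw [Nat.cast_prod, ENNReal.prod_inv_distrib]
    intro i _ j _ _
    right
    exact ENNReal.natCast_ne_top _
  rw [this, ← size_mul_prod h, Nat.cast_mul, ← hprod, ENNReal.mul_inv]
  · rfl
  · left
    exact_mod_cast (size_pos n).ne'
  · left
    exact ENNReal.natCast_ne_top _

variable (S) in
/-- The image in the `(C,F)`-space of the measure on `X_n`. -/
def pieceMeasure (n : ℕ) : Measure S.Space := (S.levelMeasure n).map (incl n)

theorem measure_eq_iSup : S.measure = ⨆ n, S.pieceMeasure n := rfl

theorem pieceMeasure_apply (n : ℕ) {A : Set S.Space} (hA : MeasurableSet A) :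
    S.pieceMeasure n A = S.levelMeasure n (incl n ⁻¹' A) :=
  Measure.map_apply (continuous_incl n).measurable hA

theorem exists_incl_of_mem {n : ℕ} {f : G} (hf : f ∈ S.F n) :
    ∃ y : S.Level n, y.1.1 = f := by
  have hc : ∀ i, n < i → (if h : n < i then
      (nonempty_C (S := S) ((Nat.zero_le n).trans_lt h)).choose else 0) ∈ S.C i := by
    intro i hi
    rw [dif_pos hi]
    exact (nonempty_C ((Nat.zero_le n).trans_lt hi)).choose_spec
  exact ⟨ofCoords f hf _ hc, rfl⟩

theorem mem_add_tailSum_iff {n m : ℕ} (h : n ≤ m) {f : G} (hf : f ∈ S.F m) :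
    f ∈ S.F n + S.tailSum n m ↔ ∃ y : S.Level n, (embed h y).1.1 = f := by
  constructor
  · intro hf'
    obtain ⟨z, rfl⟩ := exists_incl_of_mem hf
    have : incl m z ∈ S.cyl n (S.F n) := by
      rw [cyl_eq_cyl h subset_rfl]
      exact incl_mem_cyl.2 hf'
    obtain ⟨y, -, hy⟩ := this
    rw [← incl_embed h] at hy
    exact ⟨y, by rw [incl_injective m hy]⟩
  · rintro ⟨y, rfl⟩
    exact Finset.add_mem_add y.1.2 (sum_coord_mem_tailSum y le_rfl)

theorem pieceMeasure_cyl_singleton {n m : ℕ} (h : n ≤ m) {f : G} (hf : f ∈ S.F m) :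
    S.pieceMeasure n (S.cyl m {f})
      = if f ∈ S.F n + S.tailSum n m then (S.size m : ENNReal)⁻¹ else 0 := by
  rw [pieceMeasure_apply n (measurableSet_cyl (by simpa using hf))]
  have e : (incl n ⁻¹' S.cyl m {f} : Set (S.Level n)) = {x | (embed h x).1.1 = f} := by
    ext x
    rw [Set.mem_preimage, ← incl_embed h, incl_mem_cyl, Finset.mem_singleton]
    rfl
  rw [e]
  split_ifs with hf'
  · obtain ⟨y, rfl⟩ := (mem_add_tailSum_iff h hf).1 hf'
    exact levelMeasure_embed_head h y
  · rw [mem_add_tailSum_iff h hf] at hf'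
    push Not at hf'
    rw [Set.eq_empty_of_forall_notMem (s := {x : S.Level n | (embed h x).1.1 = f})
      fun x hx => hf' x hx]
    exact measure_empty

theorem pieceMeasure_restrict {n k : ℕ} (h : n ≤ k) :
    (S.pieceMeasure k).restrict (S.cyl n (S.F n)) = S.pieceMeasure n := by
  have key : ∀ m, k ≤ m → ∀ f ∈ S.F m,
      (S.pieceMeasure k).restrict (S.cyl n (S.F n)) (S.cyl m {f})
        = if f ∈ S.F n + S.tailSum n m then (S.size m : ENNReal)⁻¹ else 0 := by
    intro m hm f hf
    rw [Measure.restrict_apply (measurableSet_cyl (by simpa using hf)),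
      cyl_eq_cyl (h.trans hm) subset_rfl, cyl_inter]
    split_ifs with hf'
    · rw [Finset.singleton_inter_of_mem hf', pieceMeasure_cyl_singleton hm hf, if_pos]
      rw [← tailSum_add h hm, ← add_assoc] at hf'
      exact Finset.add_subset_add_right (add_tailSum_subset h subset_rfl) hf'
    · rw [Finset.singleton_inter_of_notMem hf', cyl_empty, measure_empty]
  refine measure_ext k (fun m hm f hf => ?_) fun m hm f hf => ?_
  · rw [key m hm f hf]
    split_ifs
    · exact ENNReal.inv_ne_top.2 (by exact_mod_cast (size_pos m).ne')
    · exact ENNReal.zero_ne_top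
  · rw [key m hm f hf, pieceMeasure_cyl_singleton (h.trans hm) hf]

theorem monotone_pieceMeasure : Monotone S.pieceMeasure := fun n k h => by
  rw [← pieceMeasure_restrict h]
  exact Measure.restrict_le_self

theorem measure_restrict (n : ℕ) :
    S.measure.restrict (S.cyl n (S.F n)) = S.pieceMeasure n := by
  have hm : MeasurableSet (S.cyl n (S.F n)) := measurableSet_cyl subset_rfl
  refine le_antisymm ?_ ?_
  -- A supremum of measures is known through its upper bounds, so a measure is built that dominates
  -- every piece and is the `n`-th piece on `X_n`.
  · have hle : S.measure ≤ S.pieceMeasure n + S.measure.restrict (S.cyl n (S.F n))ᶜ := by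
      rw [measure_eq_iSup]
      refine iSup_le fun k => ?_
      rw [← Measure.restrict_add_restrict_compl (μ := S.pieceMeasure k) hm]
      refine add_le_add ?_ (Measure.restrict_mono subset_rfl (le_iSup S.pieceMeasure k))
      rcases le_total n k with h | h
      · exact (pieceMeasure_restrict h).le
      · exact Measure.restrict_le_self.trans (monotone_pieceMeasure h)
    refine Measure.le_iff.2 fun A hA => ?_
    rw [Measure.restrict_apply hA]
    refine (hle _).trans ?_
    rw [Measure.add_apply, Measure.restrict_apply (hA.inter hm), Set.inter_assoc,
      Set.inter_compl_self, Set.inter_empty, measure_empty, add_zero]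
    exact measure_mono Set.inter_subset_left
  · rw [← pieceMeasure_restrict le_rfl]
    exact Measure.restrict_mono subset_rfl (le_iSup S.pieceMeasure n)

theorem measure_cyl_singleton {n : ℕ} {f : G} (hf : f ∈ S.F n) :
    S.measure (S.cyl n {f}) = (S.size n : ENNReal)⁻¹ := by
  have hs : {f} ⊆ S.F n := by simpa using hf
  have := congrArg (· (S.cyl n {f})) (measure_restrict (S := S) n)
  simp only [Measure.restrict_apply (measurableSet_cyl hs), cyl_inter,
    Finset.inter_eq_left.2 hs] at this
  rw [this, pieceMeasure_cyl_singleton le_rfl hf, if_pos]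
  rwa [tailSum_self, add_zero]

theorem measure_cyl_of_singleton (ν : Measure S.Space) {n : ℕ} {A : Finset G} (hA : A ⊆ S.F n) :
    ν (S.cyl n A) = ∑ a ∈ A, ν (S.cyl n {a}) := by
  rw [cyl_eq_biUnion, measure_biUnion_finset (pairwiseDisjoint_cyl n _)]
  exact fun a ha => measurableSet_cyl (by simpa using hA ha)

/-- `μ([A]_n) = #A / (#C_1 ⋯ #C_n)`. -/
theorem measure_cyl {n : ℕ} {A : Finset G} (hA : A ⊆ S.F n) :
    S.measure (S.cyl n A) = A.card * (S.size n : ENNReal)⁻¹ := by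
  rw [measure_cyl_of_singleton _ hA,
    Finset.sum_congr rfl fun a ha => measure_cyl_singleton (hA ha), Finset.sum_const,
    nsmul_eq_mul]

theorem measureReal_cyl {n : ℕ} {A : Finset G} (hA : A ⊆ S.F n) :
    S.measure.real (S.cyl n A) = A.card / S.size n := by
  rw [Measure.real, measure_cyl hA]
  simp [div_eq_mul_inv]

theorem size_ne_zero (n : ℕ) : (S.size n : ENNReal) ≠ 0 := by exact_mod_cast (size_pos n).ne'

theorem measure_cyl_lt_top {n : ℕ} {A : Finset G} (hA : A ⊆ S.F n) : S.measure (S.cyl n A) < ⊤ := by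
  rw [measure_cyl hA]
  exact ENNReal.mul_lt_top (ENNReal.natCast_lt_top _)
    (ENNReal.inv_lt_top.2 (pos_iff_ne_zero.2 (size_ne_zero n)))

instance : SigmaFinite S.measure :=
  ⟨⟨⟨fun n => S.cyl n (S.F n), fun _ => trivial, fun _ => measure_cyl_lt_top subset_rfl,
    iUnion_cyl_F⟩⟩⟩

/-! ### Invariance and ergodicity -/

variable (S) in
/-- The cylinder `X_0 = [0]_0`. -/
def base : Set S.Space := S.cyl 0 {0}

theorem zero_subset_F_zero : ({0} : Finset G) ⊆ S.F 0 := S.F_zero.symm.subset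

theorem measurableSet_base : MeasurableSet S.base := measurableSet_cyl zero_subset_F_zero

theorem base_eq (n : ℕ) : S.base = S.cyl n (S.tailSum 0 n) := by
  rw [base, cyl_eq_cyl (Nat.zero_le n) zero_subset_F_zero]
  congr 1
  exact zero_add _

theorem tailSum_zero_subset (n : ℕ) : S.tailSum 0 n ⊆ S.F n := by
  have := add_tailSum_subset (Nat.zero_le n) (zero_subset_F_zero (S := S))
  rwa [show ({0} : Finset G) + S.tailSum 0 n = S.tailSum 0 n from zero_add _] at this

theorem card_tailSum_zero (n : ℕ) : (S.tailSum 0 n).card = S.size n := by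
  have := card_add_tailSum (Nat.zero_le n) (zero_subset_F_zero (S := S))
  rwa [show ({0} : Finset G) + S.tailSum 0 n = S.tailSum 0 n from zero_add _, size_zero,
    Finset.card_singleton, one_mul, mul_one] at this

theorem measure_base : S.measure S.base = 1 := by
  rw [base, measure_cyl zero_subset_F_zero, size_zero]
  simp

theorem measureReal_base : S.measure.real S.base = 1 := by
  rw [Measure.real, measure_base, ENNReal.toReal_one]

instance : VAddInvariantMeasure G S.Space S.measure := by
  refine ⟨fun g A hA => ?_⟩
  suffices S.measure.map (g +ᵥ ·) = S.measure by
    rw [← Measure.map_apply (measurable_const_vadd g) hA, this]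
  have hmap : ∀ n, ∀ f ∈ S.F n,
      S.measure.map (g +ᵥ ·) (S.cyl n {f}) = (S.size n : ENNReal)⁻¹ := by
    intro n f hf
    have hs : {f} ⊆ S.F n := by simpa using hf
    -- At a level that absorbs `-g`, the preimage is again a cylinder, over a translated set of
    -- heads of the same cardinality.
    obtain ⟨m, hm, -, h, e⟩ := exists_vadd_cyl_eq (S := S) (-g) hs 0
    rw [Measure.map_apply (measurable_const_vadd g) (measurableSet_cyl hs), Set.preimage_vadd, e,
      measure_cyl h, Finset.card_singleton_add]
    have := card_add_tailSum hm hs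
    rw [Finset.card_singleton, one_mul] at this
    rw [← this, Nat.cast_mul, ENNReal.mul_inv (Or.inr (ENNReal.natCast_ne_top _))
      (Or.inr (size_ne_zero n)), ← mul_assoc, ENNReal.mul_inv_cancel, one_mul]
    · intro h0
      have := size_pos (S := S) m
      simp_all
    · exact ENNReal.natCast_ne_top _
  refine measure_ext 0 (fun n _ f hf => ?_) fun n _ f hf => ?_
  · rw [hmap n f hf]
    exact ENNReal.inv_ne_top.2 (size_ne_zero n)
  · rw [hmap n f hf, measure_cyl_singleton hf]

/-- A measure that is finite on `X_0` and invariant is a multiple of the `(C,F)`-measure. -/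
theorem eq_smul_measure {ν : Measure S.Space} (hν : ν S.base ≠ ⊤)
    (hinv : ∀ (g : G) (A : Set S.Space), MeasurableSet A → ν (g +ᵥ A) = ν A) :
    ν = ν S.base • S.measure := by
  have key : ∀ n, ∀ f ∈ S.F n, ν (S.cyl n {f}) = ν S.base * (S.size n : ENNReal)⁻¹ := by
    intro n f hf
    -- The base is a disjoint union of `#C_1 ⋯ #C_n` translates of `[f]_n`.
    have h₁ : ν S.base = S.size n * ν (S.cyl n {f}) := by
      rw [base_eq n, measure_cyl_of_singleton ν (tailSum_zero_subset n), ← card_tailSum_zero,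
        ← nsmul_eq_mul]
      refine Finset.sum_eq_card_nsmul fun a ha => ?_
      rw [← vadd_cyl_singleton hf (tailSum_zero_subset n ha),
        hinv _ _ (measurableSet_cyl (by simpa using hf))]
    rw [h₁, mul_comm, ← mul_assoc, ENNReal.inv_mul_cancel (size_ne_zero n)
      (ENNReal.natCast_ne_top _), one_mul]
  refine measure_ext 0 (fun n _ f hf => ?_) fun n _ f hf => ?_
  · rw [key n f hf]
    exact ENNReal.mul_ne_top hν (ENNReal.inv_ne_top.2 (size_ne_zero n))
  · rw [key n f hf, Measure.smul_apply, measure_cyl_singleton hf, smul_eq_mul]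

/-- A measurable set that is invariant modulo null sets is null or conull. -/
theorem measure_eq_zero_or_compl {A : Set S.Space} (hA : MeasurableSet A)
    (hinv : ∀ g : G, (g +ᵥ ·) ⁻¹' A =ᵐ[S.measure] A) : S.measure A = 0 ∨ S.measure Aᶜ = 0 := by
  -- Invariance of `A` makes the restriction of `μ` to `A` an invariant measure, hence a multiple of
  -- `μ`. Evaluating at `Aᶜ` shows that the factor or `μ(Aᶜ)` vanishes.
  have e := eq_smul_measure (S := S) (ν := S.measure.restrict A) ?_ fun g B hB => ?_
  · have h := congrArg (· Aᶜ) e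
    simp only [Measure.restrict_apply hA.compl, Set.compl_inter_self, measure_empty,
      Measure.smul_apply, smul_eq_mul] at h
    rcases mul_eq_zero.1 h.symm with h | h
    · rw [h, zero_smul, Measure.restrict_eq_zero] at e
      exact Or.inl e
    · exact Or.inr h
  · exact ((Measure.restrict_apply_le _ _).trans_lt (by rw [measure_base]; simp)).ne
  · rw [Measure.restrict_apply (hB.const_vadd g), Measure.restrict_apply hB,
      ← measure_preimage_vadd (μ := S.measure) g ((g +ᵥ B) ∩ A), Set.preimage_inter]
    refine measure_congr ?_
    rw [Set.preimage_vadd, neg_vadd_vadd]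
    exact (ae_eq_refl B).inter (hinv g)

instance : ErgodicVAdd G S.Space S.measure :=
  ⟨fun {A} hA hinv => by
    rw [eventuallyConst_set']
    rcases measure_eq_zero_or_compl hA hinv with h | h
    · exact Or.inl (ae_eq_empty.2 h)
    · exact Or.inr (ae_eq_univ.2 h)⟩

/-! ### Nonnull intersections with translates; conservativity -/

/-- Some translate of a nonnull set meets a given nonnull set in a nonnull set. -/
theorem exists_measure_inter_vadd_ne_zero [Countable G] {A B : Set S.Space}
    (hB : MeasurableSet B) (hA₀ : S.measure A ≠ 0) (hB₀ : S.measure B ≠ 0) :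
    ∃ g : G, S.measure (A ∩ (g +ᵥ B)) ≠ 0 := by
  by_contra! h
  have hU : MeasurableSet (⋃ g : G, g +ᵥ B) := MeasurableSet.iUnion fun g => hB.const_vadd g
  have hinv : ∀ g : G, (g +ᵥ ·) ⁻¹' (⋃ g : G, g +ᵥ B) = ⋃ g : G, g +ᵥ B := by
    intro g
    rw [Set.preimage_iUnion]
    simp only [Set.preimage_vadd, vadd_vadd]
    exact (Equiv.addLeft (-g)).surjective.iUnion_comp fun g => g +ᵥ B
  rcases measure_eq_zero_or_compl hU fun g => (hinv g).eventuallyEq with h' | h'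
  · refine hB₀ (measure_mono_null ?_ h')
    exact fun x hx => Set.mem_iUnion.2 ⟨0, by rwa [zero_vadd]⟩
  · refine hA₀ (measure_mono_null (t := (⋃ g : G, A ∩ (g +ᵥ B)) ∪ (⋃ g : G, g +ᵥ B)ᶜ) ?_
      (measure_union_null (measure_iUnion_null h) h'))
    rw [← Set.inter_iUnion]
    intro x hx
    by_cases hxU : x ∈ ⋃ g : G, g +ᵥ B
    · exact Or.inl ⟨hx, hxU⟩
    · exact Or.inr hxU

/-- The measure has no atoms: a nonnull set splits into two nonnull parts. -/
theorem exists_measure_inter_sdiff_ne_zero {A : Set S.Space} (hA : S.measure A ≠ 0) :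
    ∃ B, MeasurableSet B ∧ S.measure (A ∩ B) ≠ 0 ∧ S.measure (A \ B) ≠ 0 := by
  obtain ⟨p, hp⟩ : ∃ p, S.measure (A ∩ S.cyl p (S.F p)) ≠ 0 := by
    by_contra! h
    refine hA ?_
    rw [← Set.inter_univ A, ← iUnion_cyl_F, Set.inter_iUnion]
    exact measure_iUnion_null h
  -- At level `n ≥ q` every `[f]_n` has mass at most `2 ^ (-n) < μ(A)`, so it cannot contain almost
  -- all of `A`.
  obtain ⟨q, hq⟩ := ENNReal.exists_inv_two_pow_lt hA
  obtain ⟨n, hpn, hqn⟩ : ∃ n, p ≤ n ∧ q ≤ n := ⟨max p q, le_max_left _ _, le_max_right _ _⟩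
  obtain ⟨f, hf, hfA⟩ : ∃ f ∈ S.F n, S.measure (A ∩ S.cyl n {f}) ≠ 0 := by
    by_contra! h
    refine hp (measure_mono_null (Set.inter_subset_inter_right A (monotone_cyl_F hpn)) ?_)
    simp only
    rw [cyl_eq_biUnion, Set.inter_iUnion₂]
    exact (measure_biUnion_null_iff (S.F n).countable_toSet).2 h
  refine ⟨S.cyl n {f}, measurableSet_cyl (by simpa using hf), hfA, fun h₀ => ?_⟩
  have h₁ : S.measure A ≤ S.measure (S.cyl n {f}) := by
    refine (measure_mono (t := S.cyl n {f} ∪ A \ S.cyl n {f}) ?_).trans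
      ((measure_union_le _ _).trans (by rw [h₀, add_zero]))
    rw [Set.union_sdiff_self]
    exact Set.subset_union_right
  refine (h₁.trans_lt' hq).not_ge ?_
  rw [measure_cyl_singleton hf, ← ENNReal.inv_pow]
  refine ENNReal.inv_le_inv.2 ?_
  exact_mod_cast (Nat.pow_le_pow_right two_pos hqn).trans (two_pow_le_size n)

/-- Split `A` into two disjoint nonnull parts and translate one onto the other: disjointness forces
the translation to be nonzero. -/
theorem exists_ne_zero_measure_inter_vadd_ne_zero [Countable G] {A : Set S.Space}
    (hA : MeasurableSet A) (hA₀ : S.measure A ≠ 0) :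
    ∃ g : G, g ≠ 0 ∧ S.measure (A ∩ (g +ᵥ A)) ≠ 0 := by
  obtain ⟨B, hB, h₁, h₂⟩ := exists_measure_inter_sdiff_ne_zero hA₀
  obtain ⟨g, hg⟩ := exists_measure_inter_vadd_ne_zero (hA.diff hB) h₁ h₂
  refine ⟨g, ?_, fun h => hg (measure_mono_null (Set.inter_subset_inter Set.inter_subset_left
    (Set.vadd_set_mono Set.sdiff_subset)) h)⟩
  rintro rfl
  refine hg ?_
  rw [zero_vadd, Set.inter_assoc, Set.inter_sdiff_self, Set.inter_empty, measure_empty]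
/-! ### Sums over returns -/

variable (S) in
/-- The sum `∑_{g ∈ E} μ(A ∩ T_g B)`. -/
def returnSum (E : Finset G) (A B : Set S.Space) : ℝ := ∑ g ∈ E, S.measure.real (A ∩ (g +ᵥ B))

theorem returnSum_pos {E : Finset G} {A : Set S.Space} (hE : 0 ∈ E) (hA : S.measure A ≠ 0)
    (hA' : S.measure A ≠ ⊤) : 0 < S.returnSum E A A := by
  refine Finset.sum_pos' (fun _ _ => measureReal_nonneg) ⟨0, hE, ?_⟩
  rw [zero_vadd, Set.inter_self]
  exact ENNReal.toReal_pos hA hA'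

theorem F_nonempty (n : ℕ) : (S.F n).Nonempty := by
  obtain ⟨d, hd⟩ : (S.tailSum 0 n).Nonempty := Finset.card_pos.1 (by
    rw [card_tailSum_zero]
    exact size_pos n)
  exact ⟨d, tailSum_zero_subset n hd⟩

theorem zero_mem_F_sub_F (n : ℕ) : 0 ∈ S.F n - S.F n := by
  obtain ⟨f, hf⟩ := F_nonempty (S := S) n
  exact Finset.mem_sub.2 ⟨f, hf, f, hf, sub_self f⟩

theorem monotone_F_sub_F : Monotone fun n => S.F n - S.F n := by
  refine monotone_nat_of_le_succ fun n => ?_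
  intro g hg
  obtain ⟨a, ha, b, hb, rfl⟩ := Finset.mem_sub.1 hg
  obtain ⟨c, hc⟩ := nonempty_C (S := S) n.succ_pos
  exact Finset.mem_sub.2 ⟨a + c, S.add_subset n (Finset.add_mem_add ha hc), b + c,
    S.add_subset n (Finset.add_mem_add hb hc), add_sub_add_right_eq_sub a b c⟩

theorem measureReal_vadd (g : G) (A : Set S.Space) :
    S.measure.real (g +ᵥ A) = S.measure.real A :=
  congrArg ENNReal.toReal (measure_vadd S.measure g A)

theorem measure_cyl_ne_zero {n : ℕ} {f : G} (hf : f ∈ S.F n) : S.measure (S.cyl n {f}) ≠ 0 := by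
  rw [measure_cyl_singleton hf]
  exact ENNReal.inv_ne_zero.2 (ENNReal.natCast_ne_top _)

theorem returnSum_cyl_singleton {l : ℕ} (h₀ : 0 ∈ S.F l) {a b : G} (ha : a ∈ S.F l)
    (hb : b ∈ S.F l) (E : Finset G) :
    S.returnSum E (S.cyl l {a}) (S.cyl l {b})
      = S.returnSum (E + {b - a}) (S.cyl l {0}) (S.cyl l {0}) := by
  rw [returnSum, returnSum, show E + {b - a} = E.image (· + (b - a)) from
    Finset.image₂_singleton_right,
    Finset.sum_image (add_left_injective (b - a)).injOn]
  refine Finset.sum_congr rfl fun g _ => ?_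
  have ea : S.cyl l {a} = a +ᵥ S.cyl l {0} := by
    rw [← vadd_cyl_singleton h₀ ha, sub_zero]
  have eb : S.cyl l {b} = b +ᵥ S.cyl l {0} := by
    rw [← vadd_cyl_singleton h₀ hb, sub_zero]
  rw [← measureReal_vadd a (S.cyl l {0} ∩ _), Set.vadd_set_inter, vadd_vadd, ea, eb, vadd_vadd,
    show a + (g + (b - a)) = g + b by abel]

theorem measureReal_cyl_inter {l : ℕ} {A : Finset G} (hA : A ⊆ S.F l) {W : Set S.Space}
    (hW : MeasurableSet W) :
    S.measure.real (S.cyl l A ∩ W) = ∑ a ∈ A, S.measure.real (S.cyl l {a} ∩ W) := by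
  have hs : ∀ a ∈ A, MeasurableSet (S.cyl l {a}) :=
    fun a ha => measurableSet_cyl (by simpa using hA ha)
  rw [cyl_eq_biUnion, Set.iUnion₂_inter]
  refine measureReal_biUnion_finset ?_ (fun a ha => (hs a ha).inter hW) fun a ha => ?_
  · exact fun a ha b hb hab => (pairwiseDisjoint_cyl l _ ha hb hab).mono Set.inter_subset_left
      Set.inter_subset_left
  · exact ((measure_mono Set.inter_subset_left).trans_lt
      (measure_cyl_lt_top (by simpa using hA ha))).ne

theorem inter_vadd_eq (g : G) (A B : Set S.Space) :
    A ∩ (g +ᵥ B) = g +ᵥ (B ∩ (-g +ᵥ A)) := by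
  rw [Set.vadd_set_inter, vadd_neg_vadd, Set.inter_comm]

theorem returnSum_cyl {l : ℕ} {A B : Finset G} (hA : A ⊆ S.F l) (hB : B ⊆ S.F l)
    (E : Finset G) :
    S.returnSum E (S.cyl l A) (S.cyl l B)
      = ∑ a ∈ A, ∑ b ∈ B, S.returnSum E (S.cyl l {a}) (S.cyl l {b}) := by
  have : ∀ g : G, S.measure.real (S.cyl l A ∩ (g +ᵥ S.cyl l B))
      = ∑ a ∈ A, ∑ b ∈ B, S.measure.real (S.cyl l {a} ∩ (g +ᵥ S.cyl l {b})) := by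
    intro g
    rw [measureReal_cyl_inter hA ((measurableSet_cyl hB).const_vadd g)]
    refine Finset.sum_congr rfl fun a ha => ?_
    rw [inter_vadd_eq, measureReal_vadd, measureReal_cyl_inter hB
      ((measurableSet_cyl (by simpa using hA ha)).const_vadd _)]
    refine Finset.sum_congr rfl fun b _ => ?_
    rw [inter_vadd_eq g (S.cyl l {a}), measureReal_vadd]
  simp only [returnSum, this]
  rw [Finset.sum_comm]
  exact Finset.sum_congr rfl fun a _ => Finset.sum_comm

theorem returnRatio_eq (A B : Set S.Space) (n : ℕ) :
    S.returnRatio A B n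
      = S.returnSum (S.F n - S.F n) A B / S.returnSum (S.F n - S.F n) S.base S.base := rfl

theorem tendsto_returnSum_cyl_div (h : S.ShiftCondition) {l : ℕ} (hl : 0 < l) (h₀ : 0 ∈ S.F l)
    {A B : Finset G} (hA : A ⊆ S.F l) (hB : B ⊆ S.F l) :
    Tendsto (fun n => S.returnSum (S.F n - S.F n) (S.cyl l A) (S.cyl l B) /
      S.returnSum (S.F n - S.F n) (S.cyl l {0}) (S.cyl l {0})) atTop
      (𝓝 (A.card * B.card)) := by
  have hpos : ∀ n, S.returnSum (S.F n - S.F n) (S.cyl l {0}) (S.cyl l {0}) ≠ 0 := fun n =>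
    (returnSum_pos (zero_mem_F_sub_F n) (measure_cyl_ne_zero h₀)
      (measure_cyl_lt_top (by simpa using h₀)).ne).ne'
  have e : ((A.card * B.card : ℕ) : ℝ) = ∑ a ∈ A, ∑ b ∈ B, (1 : ℝ) := by simp
  rw [← Nat.cast_mul, e]
  simp only [returnSum_cyl hA hB, Finset.sum_div]
  refine tendsto_finsetSum _ fun a ha => tendsto_finsetSum _ fun b hb => ?_
  simp only [returnSum_cyl_singleton h₀ (hA ha) (hB hb)]
  exact (isEquivalent_iff_tendsto_one (Eventually.of_forall hpos)).1
    (h l hl (b - a) (Finset.sub_mem_sub (hB hb) (hA ha)))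

/-- Normalising by the return sum of `[0]_l`, the pair `A, B` gives the product of the numbers of
heads and the base gives `(#C_1 ⋯ #C_l) ^ 2`. The quotient of the two limits is `μ(A) μ(B)`. -/
theorem ShiftCondition.cylinderRatioCondition (h : S.ShiftCondition)
    (h_zero : ∀ n, 0 < n → (0 : G) ∈ S.F n) : S.CylinderRatioCondition := by
  rintro _ _ ⟨p, A, hA, rfl⟩ ⟨q, B, hB, rfl⟩ - -
  obtain ⟨l, hl, hpl, hql⟩ : ∃ l, 0 < l ∧ p ≤ l ∧ q ≤ l := ⟨p + q + 1, by omega⟩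
  rw [cyl_eq_cyl hpl hA, cyl_eq_cyl hql hB]
  replace hA := add_tailSum_subset hpl hA
  replace hB := add_tailSum_subset hql hB
  have hsize : (S.size l : ℝ) ≠ 0 := by exact_mod_cast (size_pos l).ne'
  have h₁ := tendsto_returnSum_cyl_div h hl (h_zero l hl) hA hB
  have h₂ := tendsto_returnSum_cyl_div h hl (h_zero l hl) (tailSum_zero_subset l)
    (tailSum_zero_subset l)
  rw [card_tailSum_zero, ← base_eq] at h₂
  have h₃ := h₁.div h₂ (mul_ne_zero hsize hsize)
  rw [measureReal_cyl hA, measureReal_cyl hB, div_mul_div_comm]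
  refine h₃.congr fun n => ?_
  rw [returnRatio_eq]
  refine div_div_div_cancel_right₀ ?_ _ _
  exact (returnSum_pos (zero_mem_F_sub_F n) (measure_cyl_ne_zero (h_zero l hl))
    (measure_cyl_lt_top (by simpa using h_zero l hl)).ne).ne'

/-! ### Convolutions -/

theorem autoconv_eq [Countable G] (D E : Finset G) :
    autoconv D E = ∑ g ∈ E, ((D.filter fun d => d - g ∈ D).card : ℝ) := by
  let _ : MeasurableSpace G := ⊤
  have : DiscreteMeasurableSpace G := ⟨fun _ => trivial⟩
  have h : Measure.conv (∑ g ∈ D, Measure.dirac g) (∑ g ∈ -D, Measure.dirac g) (E : Set G)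
      = ∑ g ∈ E, ((D.filter fun d => d - g ∈ D).card : ENNReal) := by
    rw [Measure.conv, Measure.map_apply (Measurable.of_discrete) (Set.to_countable _).measurableSet,
      Measure.prod_apply (Set.to_countable _).measurableSet, lintegral_finsetSum_measure]
    simp only [lintegral_dirac, Measure.finsetSum_apply, Measure.dirac_apply]
    have e₁ : ∀ d ∈ D, ∑ x ∈ -D, Set.indicator (Prod.mk d ⁻¹' ((fun x : G × G => x.1 + x.2) ⁻¹'
        (E : Set G))) 1 x = ∑ g ∈ E, if d - g ∈ D then (1 : ENNReal) else 0 := by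
      intro d _
      classical
      simp only [Set.indicator_apply, Set.mem_preimage, Finset.mem_coe, Pi.one_apply]
      rw [← Finset.sum_filter, ← Finset.sum_filter]
      refine Finset.sum_bij' (fun x _ => d + x) (fun g _ => g - d) ?_ ?_ ?_ ?_ ?_
      · intro x hx
        rw [Finset.mem_filter, Finset.mem_neg'] at hx
        rw [Finset.mem_filter]
        exact ⟨hx.2, by simpa using hx.1⟩
      · intro g hg
        rw [Finset.mem_filter] at hg
        rw [Finset.mem_filter, Finset.mem_neg']
        exact ⟨by simpa using hg.2, by simpa using hg.1⟩
      · simp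
      · simp
      · simp
    rw [Finset.sum_congr rfl e₁, Finset.sum_comm]
    refine Finset.sum_congr rfl fun g _ => ?_
    rw [← Finset.sum_filter, Finset.sum_const, nsmul_one]
  change (Measure.conv _ _ _).toReal = _
  rw [h, ENNReal.toReal_sum fun _ _ => ENNReal.natCast_ne_top _]
  rfl

/-- With `D = C_{l+1} + ⋯ + C_L`, the cylinders `[D ∩ (g + D)]_L` increase with `L` and exhaust the
intersection. The quotient is their measure. -/
theorem tendsto_card_filter_div {l : ℕ} (h₀ : 0 ∈ S.F l) (g : G) :
    Tendsto (fun L => ((S.tailSum l L).filter fun d => d - g ∈ S.tailSum l L).card /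
      (S.size L : ℝ)) atTop (𝓝 (S.measure.real (S.cyl l {0} ∩ (g +ᵥ S.cyl l {0})))) := by
  have hs : ({0} : Finset G) ⊆ S.F l := by simpa using h₀
  have hz : ∀ L, ({0} : Finset G) + S.tailSum l L = S.tailSum l L := fun L => zero_add _
  let D : ℕ → Finset G := fun L => (S.tailSum l L).filter fun d => d - g ∈ S.tailSum l L
  have hD : ∀ L, l ≤ L → S.tailSum l L ⊆ S.F L := fun L hL => by
    simpa only [hz] using add_tailSum_subset hL hs
  have hD' : ∀ L, l ≤ L → D L ⊆ S.F L := fun L hL => (Finset.filter_subset _ _).trans (hD L hL)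
  have hcyl : ∀ L, l ≤ L → S.cyl l {0} = S.cyl L (S.tailSum l L) := fun L hL => by
    rw [cyl_eq_cyl hL hs, hz]
  have hmono : Monotone fun k => S.cyl (l + k) (D (l + k)) := by
    refine monotone_nat_of_le_succ fun k => ?_
    rw [cyl_succ (hD' (l + k) (by omega))]
    refine cyl_mono fun x hx => ?_
    obtain ⟨d, hd, c, hc, rfl⟩ := Finset.mem_add.1 hx
    rw [Finset.mem_filter] at hd
    simp only [D]
    rw [← add_assoc, tailSum_succ (by omega), Finset.mem_filter]
    refine ⟨Finset.add_mem_add hd.1 hc, ?_⟩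
    rw [add_sub_right_comm]
    exact Finset.add_mem_add hd.2 hc
  have hunion : ⋃ k, S.cyl (l + k) (D (l + k)) = S.cyl l {0} ∩ (g +ᵥ S.cyl l {0}) := by
    refine subset_antisymm (Set.iUnion_subset fun k => ?_) ?_
    · rintro _ ⟨x, hx, rfl⟩
      obtain ⟨hx₁, hx₂⟩ := Finset.mem_filter.1 hx
      refine ⟨?_, ?_⟩
      · rw [hcyl (l + k) (by omega), incl_mem_cyl]
        exact hx₁
      · rw [Set.mem_vadd_set_iff_neg_vadd_mem, hcyl (l + k) (by omega)]
        have e : -g + x.1.1 = x.1.1 - g := by abel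
        rw [vadd_incl (-g) x (by rw [e]; exact hD _ (by omega) hx₂), incl_mem_cyl]
        change -g + x.1.1 ∈ _
        rwa [e]
    · rintro _ ⟨⟨x, hx, rfl⟩, ⟨_, ⟨y, hy, rfl⟩, e⟩⟩
      -- From this level on, `T_g` acts on `[0]_l` by adding `g` to the head, so both the head of
      -- `x` and its difference with `g` lie in the tail sum.
      obtain ⟨m, hm, -, hsub⟩ := exists_absorb (S := S) g hs 0
      rw [hz] at hsub
      have hx' : (embed hm x).1.1 ∈ S.tailSum l m := by
        rw [← hz]
        exact Finset.add_mem_add hx (sum_coord_mem_tailSum x le_rfl)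
      have hy' : (embed hm y).1.1 ∈ S.tailSum l m := by
        rw [← hz]
        exact Finset.add_mem_add hy (sum_coord_mem_tailSum y le_rfl)
      have hgy : g + (embed hm y).1.1 ∈ S.F m :=
        hsub (Finset.add_mem_add (Finset.mem_singleton_self g) hy')
      simp only at e
      rw [← incl_embed hm y, vadd_incl g _ hgy, ← incl_embed hm x] at e
      have e' : g + (embed hm y).1.1 = (embed hm x).1.1 := by
        rw [← incl_injective m e]
        rfl
      refine Set.mem_iUnion.2 ⟨m - l, ?_⟩
      rw [Nat.add_sub_cancel' hm, ← incl_embed hm, incl_mem_cyl, Finset.mem_filter]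
      refine ⟨hx', ?_⟩
      rw [← e', add_sub_cancel_left]
      exact hy'
  have hlim := tendsto_measure_iUnion_atTop (μ := S.measure) hmono
  rw [hunion] at hlim
  have hfin : S.measure (S.cyl l {0} ∩ (g +ᵥ S.cyl l {0})) ≠ ⊤ :=
    ((measure_mono Set.inter_subset_left).trans_lt (measure_cyl_lt_top hs)).ne
  rw [← tendsto_add_atTop_iff_nat l]
  refine ((ENNReal.tendsto_toReal hfin).comp hlim).congr fun k => ?_
  change S.measure.real _ = _
  rw [measureReal_cyl (hD' _ (by omega)), add_comm l k]

theorem tendsto_autoconv_div [Countable G] {l : ℕ} (h₀ : 0 ∈ S.F l) (E : Finset G) :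
    Tendsto (fun L => autoconv (S.tailSum l L) E / S.size L) atTop
      (𝓝 (S.returnSum E (S.cyl l {0}) (S.cyl l {0}))) := by
  simp only [autoconv_eq, Finset.sum_div]
  exact tendsto_finsetSum _ fun g _ => tendsto_card_filter_div h₀ g

/-- The factor `#C_1 ⋯ #C_L` cancels in the convolution ratio, and uniqueness of limits identifies
the inner limit with a ratio of return sums. -/
theorem ConvolutionCondition.shiftCondition [Countable G] (hc : S.ConvolutionCondition)
    (h_zero : ∀ n, 0 < n → (0 : G) ∈ S.F n) : S.ShiftCondition := by
  intro l hl h hh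
  have hZ : S.measure (S.cyl l {0}) ≠ 0 := measure_cyl_ne_zero (h_zero l hl)
  have hZ' : S.measure (S.cyl l {0}) ≠ ⊤ := (measure_cyl_lt_top (by simpa using h_zero l hl)).ne
  obtain ⟨r, hr, hr'⟩ := hc l hl h hh
  -- For `n ≥ l` the symmetric set `F_n - F_n` contains `-h`, so `0` lies in the shifted set and
  -- contributes the full mass of `[0]_l`.
  have hpos : ∀ n, l ≤ n →
      S.returnSum (S.F n - S.F n + {h}) (S.cyl l {0}) (S.cyl l {0}) ≠ 0 := by
    intro n hn
    refine (returnSum_pos ?_ hZ hZ').ne'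
    obtain ⟨a, ha, b, hb, rfl⟩ := Finset.mem_sub.1 (monotone_F_sub_F hn hh)
    exact Finset.mem_add.2 ⟨b - a, Finset.sub_mem_sub hb ha, a - b, Finset.mem_singleton_self _,
      by abel⟩
  have heq : ∀ᶠ n in atTop, r n = S.returnSum (S.F n - S.F n) (S.cyl l {0}) (S.cyl l {0}) /
      S.returnSum (S.F n - S.F n + {h}) (S.cyl l {0}) (S.cyl l {0}) := by
    filter_upwards [hr, eventually_ge_atTop l] with n hn hln
    have h₁ := tendsto_autoconv_div (h_zero l hl) (S.F n - S.F n)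
    have h₂ := tendsto_autoconv_div (h_zero l hl) (S.F n - S.F n + {h})
    have h₃ := hpos n hln
    have hlim := Tendsto.div h₁ h₂ h₃
    refine tendsto_nhds_unique hn (hlim.congr fun L => ?_)
    have hL : (S.size L : ℝ) ≠ 0 := by exact_mod_cast (size_pos L).ne'
    rw [Pi.div_apply, div_div_div_cancel_right₀ hL, tailSum]
  refine IsEquivalent.symm ?_
  refine (isEquivalent_iff_tendsto_one ((eventually_ge_atTop l).mono hpos)).2 ?_
  exact hr'.congr' heq

/-! ### Counting returns to the base -/

/-- With `D` the set of translations, `F - F ⊆ D + F`, and by symmetry `F - F ⊆ -D - F`. Adding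
these leaves `D - D + (F - F)`, and a third use of the covering gives `D - D + D + F`. -/
theorem card_quadruple_le {F : Finset G} {K : ℕ} {d : Fin K → G}
    (h : ((F - F : Finset G) : Set G) ⊆ ⋃ j, d j +ᵥ (F : Set G)) :
    (F - F + F - F).card ≤ K ^ 3 * F.card := by
  let D : Finset G := Finset.univ.image d
  have hD : D.card ≤ K := Finset.card_image_le.trans (by simp)
  have h₁ : F - F ⊆ D + F := by
    intro g hg
    obtain ⟨j, f, hf, rfl⟩ := Set.mem_iUnion.1 (h hg)
    exact Finset.add_mem_add (Finset.mem_image_of_mem d (Finset.mem_univ j)) hf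
  have h₂ : F - F ⊆ -D + -F := by
    have := Finset.neg_subset_neg h₁
    rwa [neg_sub, neg_add] at this
  have h₃ : F - F + F - F ⊆ D + (-D + (D + F)) := by
    have e₁ : F - F + F - F = F - F + (F - F) := by rw [add_sub_assoc]
    have e₂ : D + F + (-D + -F) = D + (-D + (F - F)) := by
      rw [sub_eq_add_neg, add_add_add_comm, add_assoc]
    rw [e₁]
    refine (Finset.add_subset_add h₁ h₂).trans ?_
    rw [e₂]
    exact Finset.add_subset_add_left (Finset.add_subset_add_left h₁)
  calc (F - F + F - F).card ≤ (D + (-D + (D + F))).card := Finset.card_le_card h₃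
    _ ≤ D.card * (D.card * (D.card * F.card)) := by
      refine Finset.card_add_le.trans (Nat.mul_le_mul_left _ ?_)
      refine Finset.card_add_le.trans ?_
      rw [Finset.card_neg]
      exact Nat.mul_le_mul_left _ Finset.card_add_le
    _ ≤ K * (K * (K * F.card)) := by gcongr
    _ = K ^ 3 * F.card := by ring

-- A packing argument. If `-g` sends `x` into `[f]_n` inside the base, then `e = g + f` is such that
-- `-e` sends `x` into `[0]_n`; so each `e` in the set `P` of such elements accounts for at most
-- `#C_1 ⋯ #C_n` values of `g`. The sets `e - F_n`, `e ∈ P`, are disjoint, because `-(e - f)` sends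
-- `x` into `[f]_n`, which determines `f`. They all lie in `E + F_n - F_n`.
open Classical in
theorem card_returns_mul_le {n : ℕ} (h₀ : 0 ∈ S.F n) (E : Finset G) (x : S.Space) :
    (E.filter fun g : G => -g +ᵥ x ∈ S.base).card * (S.F n).card
      ≤ S.size n * (E + S.F n - S.F n).card := by
  let P := (E + S.F n).filter fun e : G => -e +ᵥ x ∈ S.cyl n {0}
  have h₁ : (E.filter fun g : G => -g +ᵥ x ∈ S.base) ⊆ P - S.tailSum 0 n := by
    intro g hg
    obtain ⟨hgE, hgx⟩ := Finset.mem_filter.1 hg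
    rw [base_eq n] at hgx
    obtain ⟨y, hy, e⟩ := hgx
    refine Finset.mem_sub.2 ⟨g + y.1.1, Finset.mem_filter.2 ⟨Finset.add_mem_add hgE y.1.2, ?_⟩,
      y.1.1, hy, add_sub_cancel_right _ _⟩
    have h : -y.1.1 + y.1.1 ∈ S.F n := by rwa [neg_add_cancel]
    rw [neg_add_rev, add_vadd, ← e, vadd_incl _ y h, incl_mem_cyl, Finset.mem_singleton]
    exact neg_add_cancel _
  have h₂ : (P - S.F n).card = P.card * (S.F n).card := by
    refine Finset.card_image₂_iff.2 ?_
    have key : ∀ e ∈ P, ∀ f ∈ S.F n, -(e - f) +ᵥ x ∈ S.cyl n {f} := by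
      intro e he f hf
      have := Set.vadd_mem_vadd_set (a := f - 0) (Finset.mem_filter.1 he).2
      rwa [vadd_cyl_singleton h₀ hf, vadd_vadd, show f - 0 + -e = -(e - f) by abel] at this
    rintro ⟨e, f⟩ ⟨he, hf⟩ ⟨e', f'⟩ ⟨he', hf'⟩ h
    simp only at h he hf he' hf'
    have hff : f = f' := by
      by_contra hne
      refine Set.disjoint_left.1 (pairwiseDisjoint_cyl (S := S) n Set.univ trivial trivial hne)
        (key e he f hf) ?_
      rw [h]
      exact key e' he' f' hf'
    subst hff
    rw [sub_left_inj] at h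
    rw [h]
  calc _ ≤ (P - S.tailSum 0 n).card * (S.F n).card :=
        Nat.mul_le_mul_right _ (Finset.card_le_card h₁)
    _ ≤ P.card * S.size n * (S.F n).card := by
        rw [← card_tailSum_zero]
        exact Nat.mul_le_mul_right _ Finset.card_sub_le
    _ = S.size n * (P - S.F n).card := by rw [h₂]; ring
    _ ≤ _ := Nat.mul_le_mul_left _ (Finset.card_le_card
        (Finset.sub_subset_sub_right (Finset.filter_subset _ _)))

-- The return sum is the integral over `A` of the number of visits to the base.
open Classical in
theorem returnSum_base_le {E : Finset G} {M : ℕ}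
    (hM : ∀ x : S.Space, (E.filter fun g : G => -g +ᵥ x ∈ S.base).card ≤ M) {A : Set S.Space}
    (hA' : S.measure A ≠ ⊤) : S.returnSum E A S.base ≤ M * S.measure.real A := by
  have h : ∑ g ∈ E, S.measure (A ∩ (g +ᵥ S.base)) ≤ M * S.measure A := by
    calc ∑ g ∈ E, S.measure (A ∩ (g +ᵥ S.base))
        = ∑ g ∈ E, ∫⁻ x in A, (g +ᵥ S.base).indicator 1 x ∂S.measure := by
          refine Finset.sum_congr rfl fun g _ => ?_
          have hg : MeasurableSet (g +ᵥ S.base) := measurableSet_base.const_vadd g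
          rw [lintegral_indicator_one hg, Measure.restrict_apply hg, Set.inter_comm]
      _ = ∫⁻ x in A, ∑ g ∈ E, (g +ᵥ S.base).indicator 1 x ∂S.measure :=
          (lintegral_finsetSum _ fun g _ =>
            measurable_one.indicator (measurableSet_base.const_vadd g)).symm
      _ ≤ ∫⁻ _ in A, M ∂S.measure := by
          refine lintegral_mono fun x => ?_
          simp only [Set.indicator_apply, Set.mem_vadd_set_iff_neg_vadd_mem, Pi.one_apply]
          rw [← Finset.sum_filter, Finset.sum_const, nsmul_one]
          exact_mod_cast hM x
      _ = M * S.measure A := setLIntegral_const _ _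
  have h' := ENNReal.toReal_mono (ENNReal.mul_ne_top (ENNReal.natCast_ne_top M) hA') h
  rwa [ENNReal.toReal_mul, ENNReal.toReal_natCast, ENNReal.toReal_sum fun g _ =>
    ((measure_mono Set.inter_subset_left).trans_lt hA'.lt_top).ne] at h'

/-- The base is a union of `#C_1 ⋯ #C_n` cylinders `[a]_n`. Each ordered pair of them is matched
exactly by the single translation `a - b`, contributing `1 / (#C_1 ⋯ #C_n)`. -/
theorem size_le_returnSum_base (n : ℕ) :
    (S.size n : ℝ) ≤ S.returnSum (S.F n - S.F n) S.base S.base := by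
  have hD := tailSum_zero_subset (S := S) n
  have hpos : (0 : ℝ) < S.size n := by exact_mod_cast size_pos n
  have key : ∀ a ∈ S.tailSum 0 n, ∀ b ∈ S.tailSum 0 n,
      1 / (S.size n : ℝ) ≤ S.returnSum (S.F n - S.F n) (S.cyl n {a}) (S.cyl n {b}) := by
    intro a ha b hb
    have h := Finset.single_le_sum
      (f := fun g => S.measure.real (S.cyl n {a} ∩ (g +ᵥ S.cyl n {b})))
      (fun _ _ => measureReal_nonneg) (Finset.sub_mem_sub (hD ha) (hD hb))
    refine le_trans (le_of_eq ?_) h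
    rw [vadd_cyl_singleton (hD hb) (hD ha), Set.inter_self,
      measureReal_cyl (by simpa using hD ha), Finset.card_singleton, Nat.cast_one]
  rw [base_eq n, returnSum_cyl hD hD]
  calc (S.size n : ℝ) = ∑ a ∈ S.tailSum 0 n, ∑ b ∈ S.tailSum 0 n, 1 / (S.size n : ℝ) := by
        simp only [Finset.sum_const, card_tailSum_zero, nsmul_eq_mul]
        field_simp
    _ ≤ _ := Finset.sum_le_sum fun a ha => Finset.sum_le_sum fun b hb => key a ha b hb

theorem returnSum_base_base_pos (n : ℕ) : 0 < S.returnSum (S.F n - S.F n) S.base S.base :=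
  (Nat.cast_pos.2 (size_pos n)).trans_le (size_le_returnSum_base n)

variable (S) in
/-- The sets `F_n - F_n` are covered by `K` translates of `F_n`. -/
def IsCoveredBy (K : ℕ) : Prop :=
  ∀ n, ∃ d : Fin K → G, ((S.F n - S.F n : Finset G) : Set G) ⊆ ⋃ j, d j +ᵥ (S.F n : Set G)

theorem returnSum_base_le_mul {K : ℕ} (hK : S.IsCoveredBy K) {n : ℕ} (h₀ : 0 ∈ S.F n)
    {A : Set S.Space} (hA : S.measure A ≠ ⊤) :
    S.returnSum (S.F n - S.F n) A S.base
      ≤ K ^ 3 * S.returnSum (S.F n - S.F n) S.base S.base * S.measure.real A := by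
  classical
  obtain ⟨d, hd⟩ := hK n
  have hM : ∀ x : S.Space, ((S.F n - S.F n).filter fun g : G => -g +ᵥ x ∈ S.base).card
      ≤ K ^ 3 * S.size n := by
    intro x
    refine Nat.le_of_mul_le_mul_right ?_ (Finset.card_pos.2 (F_nonempty (S := S) n))
    calc _ ≤ S.size n * (S.F n - S.F n + S.F n - S.F n).card := card_returns_mul_le h₀ _ x
      _ ≤ S.size n * (K ^ 3 * (S.F n).card) := Nat.mul_le_mul_left _ (card_quadruple_le hd)
      _ = _ := by ring
  refine (returnSum_base_le hM hA).trans ?_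
  push_cast
  gcongr
  exact size_le_returnSum_base n

/-! ### Dependence of return sums on the sets -/

theorem returnSum_comm (E : Finset G) (A B : Set S.Space) :
    S.returnSum E A B = S.returnSum (-E) B A := by
  rw [returnSum, returnSum, Finset.sum_neg_index]
  refine Finset.sum_congr rfl fun g _ => ?_
  rw [inter_vadd_eq, measureReal_vadd]

open scoped symmDiff

theorem abs_returnSum_sub_le (E : Finset G) {A B A' B' : Set S.Space} (hA : MeasurableSet A)
    (hB : MeasurableSet B) (hA' : MeasurableSet A') (hB' : MeasurableSet B')
    (hAb : A ⊆ S.base) (hBb : B ⊆ S.base) (hAb' : A' ⊆ S.base) (hBb' : B' ⊆ S.base) :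
    |S.returnSum E A B - S.returnSum E A' B'|
      ≤ S.returnSum E (A ∆ A') S.base + S.returnSum E S.base (B ∆ B') := by
  rw [returnSum, returnSum, returnSum, returnSum, ← Finset.sum_sub_distrib,
    ← Finset.sum_add_distrib]
  refine (Finset.abs_sum_le_sum_abs _ _).trans (Finset.sum_le_sum fun g _ => ?_)
  have hfin : ∀ U : Set S.Space, U ⊆ S.base → S.measure U ≠ ⊤ := fun U hU =>
    ((measure_mono hU).trans_lt (by rw [measure_base]; exact ENNReal.one_lt_top)).ne
  have hfin' : ∀ U V : Set S.Space, U ⊆ S.base → S.measure (U ∩ V) ≠ ⊤ := fun U V hU =>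
    hfin _ (Set.inter_subset_left.trans hU)
  refine (abs_measureReal_sub_le_measureReal_symmDiff'
    (hA.inter (hB.const_vadd g)).nullMeasurableSet
    (hA'.inter (hB'.const_vadd g)).nullMeasurableSet (hfin' _ _ hAb) (hfin' _ _ hAb')).trans ?_
  have hsub : (A ∩ (g +ᵥ B)) ∆ (A' ∩ (g +ᵥ B'))
      ⊆ (A ∆ A' ∩ (g +ᵥ S.base)) ∪ (S.base ∩ (g +ᵥ (B ∆ B'))) := by
    intro x hx
    simp only [Set.mem_symmDiff, Set.mem_inter_iff, Set.mem_union,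
      Set.mem_vadd_set_iff_neg_vadd_mem] at hx ⊢
    have h₁ := @hAb x
    have h₂ := @hAb' x
    have h₃ := @hBb (-g +ᵥ x)
    have h₄ := @hBb' (-g +ᵥ x)
    tauto
  have hAA : A ∆ A' ⊆ S.base := Set.symmDiff_subset_union.trans (Set.union_subset hAb hAb')
  refine (measureReal_mono hsub ?_).trans (measureReal_union_le _ _)
  exact (measure_union_lt_top (hfin' _ _ hAA).lt_top (hfin' _ _ subset_rfl).lt_top).ne

/-! ### Approximation by cylinders -/

theorem isSetRing_isCylinder : IsSetRing {A | S.IsCylinder A} := by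
  have common : ∀ A B : Set S.Space, S.IsCylinder A → S.IsCylinder B → ∃ n A' B',
      A' ⊆ S.F n ∧ B' ⊆ S.F n ∧ A = S.cyl n A' ∧ B = S.cyl n B' := by
    rintro _ _ ⟨p, A, hA, rfl⟩ ⟨q, B, hB, rfl⟩
    exact ⟨max p q, _, _, add_tailSum_subset (le_max_left p q) hA,
      add_tailSum_subset (le_max_right p q) hB, cyl_eq_cyl (le_max_left p q) hA,
      cyl_eq_cyl (le_max_right p q) hB⟩
  refine ⟨⟨0, ∅, Finset.empty_subset _, (cyl_empty 0).symm⟩, fun A B hA hB => ?_,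
    fun A B hA hB => ?_⟩
  · obtain ⟨n, A, B, hA', hB', rfl, rfl⟩ := common A B hA hB
    exact ⟨n, A ∪ B, Finset.union_subset hA' hB', cyl_union n A B⟩
  · obtain ⟨n, A, B, hA', hB', rfl, rfl⟩ := common A B hA hB
    exact ⟨n, A \ B, Finset.sdiff_subset.trans hA', cyl_sdiff n A B⟩

theorem IsCylinder.measurableSet {A : Set S.Space} (hA : S.IsCylinder A) : MeasurableSet A := by
  obtain ⟨n, A, hA, rfl⟩ := hA
  exact measurableSet_cyl hA

theorem pointCylinders_subset (N : ℕ) : S.pointCylinders N ⊆ {A | S.IsCylinder A} := by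
  rintro _ ⟨n, -, f, hf, rfl⟩
  exact ⟨n, {f}, by simpa using hf, rfl⟩

theorem isCylinder_base : S.IsCylinder S.base := ⟨0, {0}, zero_subset_F_zero, rfl⟩

theorem exists_isCylinder_measureReal_symmDiff_lt {A : Set S.Space} (hA : MeasurableSet A)
    (hAb : A ⊆ S.base) {ε : ℝ} (hε : 0 < ε) :
    ∃ B, S.IsCylinder B ∧ B ⊆ S.base ∧ S.measure.real (A ∆ B) < ε := by
  have hgen : (inferInstance : MeasurableSpace S.Space)
      = MeasurableSpace.generateFrom {A | S.IsCylinder A} := by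
    refine le_antisymm ?_ (MeasurableSpace.generateFrom_le fun A hA => hA.measurableSet)
    rw [generateFrom_pointCylinders 0]
    exact MeasurableSpace.generateFrom_mono (pointCylinders_subset 0)
  have : IsFiniteMeasure (S.measure.restrict S.base) :=
    isFiniteMeasure_restrict.2 (by rw [measure_base]; exact ENNReal.one_ne_top)
  obtain ⟨t, ht, hlt⟩ := exists_measure_symmDiff_lt_of_generateFrom_isSetRing
    (μ := S.measure.restrict S.base) isSetRing_isCylinder
    ⟨S.pointCylinders 0, countable_pointCylinders 0, pointCylinders_subset 0, by
      rw [sUnion_pointCylinders, Set.compl_univ, measure_empty]⟩ hgen hA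
    (ENNReal.ofReal_pos.2 hε)
  refine ⟨t ∩ S.base, isSetRing_isCylinder.inter_mem ht isCylinder_base, Set.inter_subset_right,
    ?_⟩
  have e : A ∆ (t ∩ S.base) = t ∆ A ∩ S.base := by
    ext x
    have := @hAb x
    simp only [Set.mem_symmDiff, Set.mem_inter_iff]
    tauto
  rw [Measure.restrict_apply ((ht : S.IsCylinder t).measurableSet.symmDiff hA), ← e] at hlt
  exact (ENNReal.toReal_lt_of_lt_ofReal hlt)

theorem measureReal_le_one {A : Set S.Space} (hA : A ⊆ S.base) : S.measure.real A ≤ 1 := by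
  rw [← measureReal_base (S := S)]
  exact measureReal_mono hA (by rw [measure_base]; exact ENNReal.one_ne_top)

theorem tendsto_returnRatio (h : S.CylinderRatioCondition)
    (h_zero : ∀ n, 0 < n → (0 : G) ∈ S.F n) {K : ℕ} (hK : S.IsCoveredBy K)
    {A B : Set S.Space} (hA : MeasurableSet A) (hB : MeasurableSet B)
    (hAb : A ⊆ S.base) (hBb : B ⊆ S.base) :
    Tendsto (S.returnRatio A B) atTop (𝓝 (S.measure.real A * S.measure.real B)) := by
  have h₀ : ∀ n, 0 ∈ S.F n := fun n => by
    rcases n.eq_zero_or_pos with rfl | hn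
    · simp [S.F_zero]
    · exact h_zero n hn
  have hbase : S.measure S.base ≠ ⊤ := by
    rw [measure_base]
    exact ENNReal.one_ne_top
  have hfin : ∀ U : Set S.Space, U ⊆ S.base → S.measure U ≠ ⊤ := fun U hU =>
    ((measure_mono hU).trans_lt hbase.lt_top).ne
  rw [Metric.tendsto_atTop']
  intro ε hε
  let c : ℝ := K ^ 3
  have hc : 0 ≤ c := by positivity
  -- Replacing `A, B` by cylinders costs at most `2 c δ` in the ratio and `2 δ` in the product of
  -- measures, in all `ε / 4`; the cylinder limit costs `ε / 2`.
  let δ : ℝ := ε / (8 * (c + 1))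
  have hδ : 0 < δ := by positivity
  have hδε : 8 * ((c + 1) * δ) = ε := by
    simp only [δ]
    field_simp
  obtain ⟨A', hA', hAb', hAA'⟩ := exists_isCylinder_measureReal_symmDiff_lt hA hAb hδ
  obtain ⟨B', hB', hBb', hBB'⟩ := exists_isCylinder_measureReal_symmDiff_lt hB hBb hδ
  obtain ⟨N, hN⟩ := Metric.tendsto_atTop'.1 (h A' B' hA' hB' hAb' hBb') (ε / 2) (half_pos hε)
  refine ⟨N, fun n hn => ?_⟩
  have h₁ : |S.returnRatio A B n - S.returnRatio A' B' n| ≤ 2 * (c * δ) := by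
    have ha := returnSum_base_base_pos (S := S) n
    rw [returnRatio_eq, returnRatio_eq, ← sub_div, abs_div, abs_of_pos ha, div_le_iff₀ ha]
    refine (abs_returnSum_sub_le _ hA hB hA'.measurableSet hB'.measurableSet hAb hBb hAb'
      hBb').trans ?_
    have e₁ := returnSum_base_le_mul hK (h₀ n)
      (hfin (A ∆ A') (Set.symmDiff_subset_union.trans (Set.union_subset hAb hAb')))
    have e₂ := returnSum_base_le_mul hK (h₀ n)
      (hfin (B ∆ B') (Set.symmDiff_subset_union.trans (Set.union_subset hBb hBb')))
    -- Since `F_n - F_n` is symmetric, the bound with the base in the second slot also serves for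
    -- the first.
    rw [returnSum_comm _ S.base (B ∆ B'), neg_sub]
    have hca : 0 ≤ c * S.returnSum (S.F n - S.F n) S.base S.base := mul_nonneg hc ha.le
    have e₃ := mul_le_mul_of_nonneg_left hAA'.le hca
    have e₄ := mul_le_mul_of_nonneg_left hBB'.le hca
    calc _ ≤ c * S.returnSum (S.F n - S.F n) S.base S.base * δ
          + c * S.returnSum (S.F n - S.F n) S.base S.base * δ :=
        add_le_add (e₁.trans e₃) (e₂.trans e₄)
      _ = _ := by ring
  have h₂ : |S.measure.real A' * S.measure.real B' - S.measure.real A * S.measure.real B|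
      ≤ 2 * δ := by
    have e₁ := (abs_measureReal_sub_le_measureReal_symmDiff' hA.nullMeasurableSet
      hA'.measurableSet.nullMeasurableSet (hfin A hAb) (hfin A' hAb')).trans hAA'.le
    have e₂ := (abs_measureReal_sub_le_measureReal_symmDiff' hB.nullMeasurableSet
      hB'.measurableSet.nullMeasurableSet (hfin B hBb) (hfin B' hBb')).trans hBB'.le
    rw [abs_sub_comm] at e₁ e₂
    have e : S.measure.real A' * S.measure.real B' - S.measure.real A * S.measure.real B
        = (S.measure.real A' - S.measure.real A) * S.measure.real B'
          + S.measure.real A * (S.measure.real B' - S.measure.real B) := by ring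
    rw [e]
    refine (abs_add_le _ _).trans ?_
    rw [abs_mul, abs_mul, abs_of_nonneg (measureReal_nonneg (s := B')),
      abs_of_nonneg (measureReal_nonneg (s := A)), two_mul]
    refine add_le_add ?_ ?_
    · exact (mul_le_of_le_one_right (abs_nonneg _) (measureReal_le_one hBb')).trans e₁
    · exact (mul_le_of_le_one_left (abs_nonneg _) (measureReal_le_one hAb)).trans e₂
  have h₃ := hN n hn
  rw [Real.dist_eq] at h₃ ⊢
  have h₄ := abs_sub_le (S.returnRatio A B n) (S.returnRatio A' B' n)
    (S.measure.real A * S.measure.real B)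
  have h₅ := abs_sub_le (S.returnRatio A' B' n) (S.measure.real A' * S.measure.real B')
    (S.measure.real A * S.measure.real B)
  nlinarith

/-! ### Weak rational ergodicity -/

theorem isWeaklyRationallyErgodicAlong [Countable G]
    (h : ∀ A B : Set S.Space, MeasurableSet A → MeasurableSet B → A ⊆ S.base → B ⊆ S.base →
      Tendsto (S.returnRatio A B) atTop (𝓝 (S.measure.real A * S.measure.real B))) :
    IsWeaklyRationallyErgodicAlong S.measure fun n => S.F n - S.F n where
  sigmaFinite := inferInstance
  ergodic := inferInstance
  conservative _ hA hA₀ := exists_ne_zero_measure_inter_vadd_ne_zero hA hA₀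
  monotone := monotone_F_sub_F
  exists_set := by
    refine ⟨S.base, measurableSet_base, ?_, ?_, fun A B hA hB hAb hBb => ?_⟩
    · rw [measure_base]
      exact one_pos
    · rw [measure_base]
      exact ENNReal.one_lt_top
    · refine (h A B hA hB hAb hBb).congr fun n => ?_
      rw [measureReal_base, returnRatio_eq]
      simp only [one_pow, div_one]
      exact (one_div_mul_eq_div _ _).symm

/-! ### Non-squashability -/

/-- An invariant σ-finite measure that is absolutely continuous with respect to the
`(C,F)`-measure is finite on the base. -/
theorem measure_base_ne_top_of_absolutelyContinuous {ν : Measure S.Space} [SigmaFinite ν]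
    (hac : ν ≪ S.measure)
    (hinv : ∀ (g : G) (A : Set S.Space), MeasurableSet A → ν (g +ᵥ A) = ν A) :
    ν S.base ≠ ⊤ := by
  have hwd : S.measure.withDensity (ν.rnDeriv S.measure) = ν :=
    Measure.withDensity_rnDeriv_eq ν S.measure hac
  have hm : Measurable (ν.rnDeriv S.measure) := Measure.measurable_rnDeriv ν S.measure
  -- Both functions are densities of `ν` with respect to `μ`, by invariance of the two measures.
  have hf : ∀ g : G, (fun x => ν.rnDeriv S.measure (g +ᵥ x)) =ᵐ[S.measure]
      ν.rnDeriv S.measure := by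
    intro g
    refine (withDensity_eq_iff_of_sigmaFinite
      (hm.comp (measurable_const_vadd g)).aemeasurable hm.aemeasurable).1 ?_
    refine Measure.ext fun A hA => ?_
    have e := (measurePreserving_vadd g S.measure).setLIntegral_comp_preimage
      (hA.const_vadd g) hm
    rw [Set.preimage_vadd, neg_vadd_vadd] at e
    rw [withDensity_apply _ hA]
    refine e.trans ?_
    rw [← withDensity_apply _ (hA.const_vadd g), hwd, hinv g A hA]
  have hE : ∀ t : ℕ, S.measure {x | ν.rnDeriv S.measure x ≤ t} = 0 ∨
      S.measure {x | ν.rnDeriv S.measure x ≤ t}ᶜ = 0 := by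
    intro t
    refine measure_eq_zero_or_compl (measurableSet_le hm measurable_const) fun g => ?_
    filter_upwards [hf g] with x hx
    refine propext ?_
    change ν.rnDeriv S.measure (g +ᵥ x) ≤ t ↔ ν.rnDeriv S.measure x ≤ t
    rw [hx]
  -- The sublevel sets are null or conull and, the density being finite almost everywhere, they
  -- exhaust the space up to a null set. So one is conull and the density is essentially bounded.
  obtain ⟨t, ht⟩ : ∃ t : ℕ, S.measure {x | ν.rnDeriv S.measure x ≤ t}ᶜ = 0 := by
    by_contra! h
    have h₀ : S.measure (⋃ t : ℕ, {x | ν.rnDeriv S.measure x ≤ t}) = 0 :=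
      measure_iUnion_null fun t => (hE t).resolve_right (h t)
    have h₁ : ∀ᵐ x ∂S.measure, False := by
      filter_upwards [Measure.rnDeriv_lt_top ν S.measure, measure_eq_zero_iff_ae_notMem.1 h₀]
        with x hx hx'
      obtain ⟨t, ht⟩ := ENNReal.exists_nat_gt hx.ne
      exact hx' (Set.mem_iUnion.2 ⟨t, ht.le⟩)
    have h₂ : S.measure S.base = 0 := by
      rw [(Filter.eventually_false_iff_eq_bot.1 h₁ |> ae_eq_bot.1)]
      rfl
    rw [measure_base] at h₂
    exact one_ne_zero h₂
  have hle : ν S.base ≤ t := by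
    rw [← hwd, withDensity_apply _ measurableSet_base]
    calc ∫⁻ x in S.base, ν.rnDeriv S.measure x ∂S.measure ≤ ∫⁻ _ in S.base, t ∂S.measure := by
          refine lintegral_mono_ae (ae_restrict_of_ae ?_)
          exact (measure_eq_zero_iff_ae_notMem.1 ht).mono fun x hx => not_not.1 hx
      _ = t := by rw [setLIntegral_const, measure_base, mul_one]
  exact (hle.trans_lt (ENNReal.natCast_lt_top t)).ne

theorem isNonSquashable [Countable G]
    (h : ∀ A B : Set S.Space, MeasurableSet A → MeasurableSet B → A ⊆ S.base → B ⊆ S.base →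
      Tendsto (S.returnRatio A B) atTop (𝓝 (S.measure.real A * S.measure.real B))) :
    IsNonSquashable G S.measure := by
  rintro Q ⟨hQ, R, hR, hRQ, -⟩ hcomm
  have hpre : ∀ (g : G) (A : Set S.Space), Q ⁻¹' (g +ᵥ A) =ᵐ[S.measure] g +ᵥ Q ⁻¹' A := by
    intro g A
    filter_upwards [hcomm (-g)] with x hx
    refine propext ?_
    change x ∈ Q ⁻¹' (g +ᵥ A) ↔ x ∈ g +ᵥ Q ⁻¹' A
    rw [Set.mem_preimage, Set.mem_vadd_set_iff_neg_vadd_mem, Set.mem_vadd_set_iff_neg_vadd_mem,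
      Set.mem_preimage, hx]
  have hRQ' : ∀ A : Set S.Space, Q ⁻¹' (R ⁻¹' A) =ᵐ[S.measure] A := by
    intro A
    filter_upwards [hRQ] with x hx
    refine propext ?_
    change R (Q x) ∈ A ↔ x ∈ A
    rw [show R (Q x) = x from hx]
  have hmap : ∀ A, MeasurableSet A → S.measure.map Q A = S.measure (Q ⁻¹' A) :=
    fun A hA => Measure.map_apply hQ.measurable hA
  have hinv : ∀ (g : G) (A : Set S.Space), MeasurableSet A →
      S.measure.map Q (g +ᵥ A) = S.measure.map Q A := by
    intro g A hA
    rw [hmap _ (hA.const_vadd g), hmap _ hA, measure_congr (hpre g A), measure_vadd]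
  have : SigmaFinite (S.measure.map Q) := by
    -- These sets play the role of `Q(X_n)`: their `Q`-preimages are the `X_n` modulo null sets.
    refine ⟨⟨⟨fun n => R ⁻¹' S.cyl n (S.F n), fun _ => trivial, fun n => ?_, ?_⟩⟩⟩
    · rw [hmap _ (hR.measurable (measurableSet_cyl subset_rfl)), measure_congr (hRQ' _)]
      exact measure_cyl_lt_top subset_rfl
    · rw [← Set.preimage_iUnion, iUnion_cyl_F, Set.preimage_univ]
  have hfin : S.measure.map Q S.base ≠ ⊤ :=
    measure_base_ne_top_of_absolutelyContinuous hQ.absolutelyContinuous hinv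
  have heq := eq_smul_measure hfin hinv
  set c := S.measure.map Q S.base with hc
  have hpreim : ∀ A, MeasurableSet A → S.measure.real (Q ⁻¹' A) = c.toReal * S.measure.real A := by
    intro A hA
    rw [Measure.real, ← hmap A hA, heq, Measure.smul_apply, smul_eq_mul, ENNReal.toReal_mul]
    rfl
  have hc₀ : c ≠ 0 := by
    intro h₀
    have h₁ : S.measure (Q ⁻¹' Set.univ) = 0 := by
      rw [← hmap _ MeasurableSet.univ, heq, h₀, zero_smul]
      rfl
    have h₂ := measure_mono_null (Set.subset_univ S.base) h₁
    rw [measure_base] at h₂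
    exact one_ne_zero h₂
  have hZ : S.measure (Q ⁻¹' S.base) ≠ 0 := by rwa [← hmap _ measurableSet_base]
  -- The preimage of the base may miss the base, but the limit law concerns subsets of it. The
  -- translation by `k` makes it possible to bring a nonnull part of the preimage into the base.
  obtain ⟨k, hk⟩ := exists_measure_inter_vadd_ne_zero (B := S.base) measurableSet_base hZ (by
    rw [measure_base]
    exact one_ne_zero)
  obtain ⟨D, hD⟩ : ∃ D, D = Q ⁻¹' S.base ∩ (k +ᵥ S.base) := ⟨_, rfl⟩
  rw [← hD] at hk
  have hDm : MeasurableSet D := by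
    rw [hD]
    exact (hQ.measurable measurableSet_base).inter (measurableSet_base.const_vadd k)
  -- A measurable substitute for `Q(D)`, cut down to lie in the base everywhere and not just almost
  -- everywhere.
  obtain ⟨A, hA⟩ : ∃ A, A = R ⁻¹' D ∩ S.base := ⟨_, rfl⟩
  have hAm : MeasurableSet A := by
    rw [hA]
    exact (hR.measurable hDm).inter measurableSet_base
  have hQA : Q ⁻¹' A =ᵐ[S.measure] D := by
    rw [hA, Set.preimage_inter]
    refine ((hRQ' D).inter (ae_eq_refl (Q ⁻¹' S.base))).trans ?_
    exact (Set.inter_eq_left.2 (hD.subset.trans Set.inter_subset_left)).eventuallyEq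
  have hAb : A ⊆ S.base := hA.subset.trans Set.inter_subset_right
  have hDb : -k +ᵥ D ⊆ S.base := by
    rw [Set.vadd_set_subset_iff_subset_neg_vadd_set, neg_neg, hD]
    exact Set.inter_subset_right
  have hDA : S.measure.real D = c.toReal * S.measure.real A := by
    rw [← hpreim A hAm]
    exact congrArg ENNReal.toReal (measure_congr hQA).symm
  -- As `G` is Abelian, `-k` factors out of the intersection; what remains is the `Q`-preimage of `A
  -- ∩ T_g A`, because `Q` commutes with `T_g`.
  have hret : ∀ g : G, S.measure.real ((-k +ᵥ D) ∩ (g +ᵥ (-k +ᵥ D)))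
      = c.toReal * S.measure.real (A ∩ (g +ᵥ A)) := by
    intro g
    rw [← hpreim _ (hAm.inter (hAm.const_vadd g)), vadd_vadd, add_comm g, ← vadd_vadd,
      ← Set.vadd_set_inter, measureReal_vadd]
    refine congrArg ENNReal.toReal (measure_congr ?_)
    rw [Set.preimage_inter]
    refine (hQA.symm).inter (Filter.EventuallyEq.trans ?_ (hpre g A).symm)
    have := (measurePreserving_vadd (-g) S.measure).quasiMeasurePreserving.preimage_ae_eq hQA.symm
    simpa only [Set.preimage_vadd, neg_neg] using this
  have hratio : ∀ n, S.returnRatio (-k +ᵥ D) (-k +ᵥ D) n = c.toReal * S.returnRatio A A n := by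
    intro n
    have e : S.returnSum (S.F n - S.F n) (-k +ᵥ D) (-k +ᵥ D)
        = c.toReal * S.returnSum (S.F n - S.F n) A A := by
      rw [returnSum, returnSum, Finset.mul_sum]
      exact Finset.sum_congr rfl fun g _ => hret g
    rw [returnRatio_eq, returnRatio_eq, e, mul_div_assoc]
  have hlim₁ := h _ _ (hDm.const_vadd (-k)) (hDm.const_vadd (-k)) hDb hDb
  have hlim₂ := (h A A hAm hAm hAb hAb).const_mul c.toReal
  have hkey := tendsto_nhds_unique (hlim₁.congr hratio) hlim₂
  have hcpos : 0 < c.toReal := ENNReal.toReal_pos hc₀ hfin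
  have hDpos : 0 < S.measure.real D := by
    refine ENNReal.toReal_pos hk (ne_top_of_le_ne_top ?_ (measure_mono
      (hD.subset.trans Set.inter_subset_right)))
    rw [measure_vadd, measure_base]
    exact ENNReal.one_ne_top
  have hApos : 0 < S.measure.real A := by
    rw [hDA] at hDpos
    exact pos_of_mul_pos_right hDpos hcpos.le
  rw [measureReal_vadd, hDA] at hkey
  -- The two limits read `(c μ(A)) ^ 2 = c μ(A) ^ 2`, with `c` and `μ(A)` positive.
  have hc₁ : c.toReal = 1 := by
    have hne : c.toReal * (S.measure.real A * S.measure.real A) ≠ 0 := by positivity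
    refine mul_right_cancel₀ hne ?_
    linarith
  refine ⟨hQ.measurable, ?_⟩
  rw [heq, (ENNReal.toReal_eq_one_iff c).1 hc₁, one_smul]

end CFSequence

end

theorem corollary2p7 {G : Type*} [AddCommGroup G] [Countable G] [Infinite G] [DecidableEq G]
    (S : CFSequence G) (h_zero : ∀ n, 0 < n → (0 : G) ∈ S.F n)
    (h_ratio : S.CylinderRatioCondition ∨ S.ShiftCondition ∨ S.ConvolutionCondition)
    (h_cover : ∃ K : ℕ, 0 < K ∧ ∀ n, ∃ d : Fin K → G,
      ((S.F n - S.F n : Finset G) : Set G) ⊆ ⋃ j, d j +ᵥ (S.F n : Set G)) :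
    (∀ A B : Set S.Space, MeasurableSet A → MeasurableSet B →
      A ⊆ S.cyl 0 {0} → B ⊆ S.cyl 0 {0} →
      Tendsto (S.returnRatio A B) atTop (𝓝 (S.measure.real A * S.measure.real B))) ∧
    IsWeaklyRationallyErgodicAlong S.measure (fun n => S.F n - S.F n) ∧
    IsNonSquashable G S.measure := by
  obtain ⟨K, -, hK⟩ := h_cover
  have hc : S.CylinderRatioCondition := by
    rcases h_ratio with h | h | h
    · exact h
    · exact h.cylinderRatioCondition h_zero
    · exact (h.shiftCondition h_zero).cylinderRatioCondition h_zero
  have ha := fun (A B : Set S.Space) (hA : MeasurableSet A) (hB : MeasurableSet B)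
    (hAb : A ⊆ S.base) (hBb : B ⊆ S.base) =>
      CFSequence.tendsto_returnRatio hc h_zero hK hA hB hAb hBb
  exact ⟨ha, CFSequence.isWeaklyRationallyErgodicAlong ha, CFSequence.isNonSquashable ha⟩
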